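/- Let $B,C>0$ and $\delta\in\mathbb R$. For $n\in\mathbb N$ let $m=[n^\delta]$ (where $[\cdot]$ is the integer part), and let $\mathscr M_{n,\delta}(B,C)$ be the set of $(m+n)\times(m+n)$ matrices with entries in $\{0,1\}$ whose first $m$ rows and first $m$ columns have sum $[BCn]$ and whose last $n$ rows and last $n$ columns have sum $[Cn]$. Let $X=(X_{ij})$ (depending on $n$) be uniformly distributed on $\mathscr M_{n,\delta}(B,C)$. Let $V_k(\gamma)$ be the joint law of $k$ i.i.d. Bernoulli random variables with mean $\gamma$, and for laws $P,Q$ on a finite set let $d_{TV}(P,Q)=\sum_x|P(x)-Q(x)|$. Let $k=k(n)$ be a sequence of non-negative integers. All limits and asymptotic relations are for $n\to\infty$. (i) (Bottom right) If $0\le\delta<1$, $0<C<1$, $0<B\le \frac1C$ and $k=o(n^{1-\delta})$, then $$d_{TV}\big((X_{m+1,m+1},X_{m+1,m+2},\ldots,X_{m+1,m+k}),\,V_k(C)\big)\to0 .$$ (ii) (Top left) If $\frac12<\delta\le\frac23$, $0<C<\frac34$, $0<B<\dfrac1{\sqrt{\frac C3-\frac{C^2}3}+C}$ and $k=o\big(\frac{n^{2\delta-1}}{\log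 n}\big)$, then $$d_{TV}\Big((X_{1,1},\ldots,X_{1,k}),\,V_k\Big(\tfrac{B^2(1-C)}{B^2-2B+1/C}\Big)\Big)\to0 .$$ (iii) (Side block) If $0<\delta\le\frac12$, $0<C<\frac34$, $0<B<\dfrac1{\sqrt{\frac C3-\frac{C^2}3}+C}$ and $k=o\big(\frac{n^{\delta}}{\log n}\big)$, then $$d_{TV}\big((X_{1,m+1},\ldots,X_{1,m+k}),\,V_k(BC)\big)\to0 .$$ In each case, $\mathscr M_{n,\delta}(B,C)$ is non-empty and the $k(n)$ listed entries exist and lie in the block concerned, for all sufficiently large $n$. -/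

import Mathlib

open Filter Topology MeasureTheory ProbabilityTheory Asymptotics

noncomputable section

namespace BinaryContingency

/-- The set of `m × n` binary contingency tables with row sums `r` and column sums `c`. -/
def tables {m n : ℕ} (r : Fin m → ℕ) (c : Fin n → ℕ) : Set (Fin m → Fin n → Fin 2) :=
  {d | (∀ i, ∑ j, (d i j : ℕ) = r i) ∧ ∀ j, ∑ i, (d i j : ℕ) = c j}

/-- The number `[n ^ δ]` of exceptional rows (and columns). -/
def topSize (n : ℕ) (δ : ℝ) : ℕ := ⌊(n : ℝ) ^ δ⌋₊

/-- The margin vector: `[B C n]` in the first `[n ^ δ]` places, `[C n]` in the other `n` places. -/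
def margin (n : ℕ) (δ B C : ℝ) : Fin (topSize n δ + n) → ℕ :=
  fun i => if (i : ℕ) < topSize n δ then ⌊B * C * n⌋₊ else ⌊C * n⌋₊

/-- The set of binary tables of size `[n ^ δ] + n` whose row and column margins are both `margin`. -/
def tableSet (n : ℕ) (δ B C : ℝ) :
    Set (Fin (topSize n δ + n) → Fin (topSize n δ + n) → Fin 2) :=
  tables (margin n δ B C) (margin n δ B C)

/-- The entry of a table in row `i` and column `j`, counted from `1` as in matrix notation
(and `0` if there is no such entry). -/
def entry {N : ℕ} (X : Fin N → Fin N → Fin 2) (i j : ℕ) : Fin 2 :=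
  if h : (1 ≤ i ∧ i ≤ N) ∧ 1 ≤ j ∧ j ≤ N then
    X ⟨i - 1, by omega⟩ ⟨j - 1, by omega⟩
  else 0

/-- The joint law of `(X_{i, j + 1}, …, X_{i, j + k})` (indices counted from `1`),
for `X` uniformly distributed on `tableSet n δ B C`. -/
def rowLaw (n : ℕ) (δ B C : ℝ) (i j k : ℕ) : Measure (Fin k → Fin 2) :=
  (uniformOn (tableSet n δ B C)).map (fun X t => entry X i (j + (t + 1)))

/-- The Bernoulli law on `{0, 1}` with `P(1) = q` and `P(0) = 1 - q`, for `q ∈ [0, 1]`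
(other values of `q` are moved to the nearest end point of the interval). -/
def ber (q : ℝ) : Measure (Fin 2) :=
  bernoulliMeasure 1 0 (Set.projIcc (0 : ℝ) 1 zero_le_one q)

/-- The joint law `V_k(q)` of `k` independent Bernoulli variables with mean `q`. -/
def iidBer (k : ℕ) (q : ℝ) : Measure (Fin k → Fin 2) := Measure.pi fun _ => ber q

/-- Total variation distance of two laws on a finite set, normalised as
`∑ x, |P(x) - Q(x)|`. -/
def dTV {α : Type*} [Fintype α] [MeasurableSpace α] (P Q : Measure α) : ℝ :=
  ∑ x, |P.real {x} - Q.real {x}|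

/-- The limiting mean in the top left block. -/
def topLeftMean (B C : ℝ) : ℝ := B ^ 2 * (1 - C) / (B ^ 2 - 2 * B + 1 / C)

/-- The limiting mean in the top left block is a probability, so that `ber` does not change it. -/
theorem topLeftMean_mem {B C : ℝ} (hC : 0 < C) (hC1 : C < 1) :
    topLeftMean B C ∈ Set.Icc (0 : ℝ) 1 := by
  have h1 : 1 < 1 / C := by rw [lt_div_iff₀ hC]; linarith
  have hd : 0 < B ^ 2 - 2 * B + 1 / C := by nlinarith [sq_nonneg (B - 1)]
  refine ⟨div_nonneg (mul_nonneg (sq_nonneg B) (by linarith)) hd.le, ?_⟩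
  rw [topLeftMean, div_le_one hd]
  have h2 : 0 ≤ (B * C - 1) ^ 2 / C := by positivity
  have h3 : (B * C - 1) ^ 2 / C = B ^ 2 * C - 2 * B + 1 / C := by field_simp; ring
  nlinarith

end BinaryContingency

end

open BinaryContingency

open BinaryContingency

/-! Bottom right block. The last `n` entries of a bottom row are exchangeable, and their sum is `⌊C
n⌋` up to an error of at most `m`. Given the sum, the first `k` of them are a sample without
replacement, which `sum_abs_sub_le_of_exchangeable` compares with independent sampling; the total
error is of order `k m / n`.

Blocks in the top rows. Compare the uniform law with a random matrix of independent Bernoulli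
entries whose means are constant on the four blocks. If the odds have product form (row factor times
column factor), the weight of a table depends only on its margins, so all tables have the same
weight (`prod_berWeight_of_mem_tabs`). If moreover the expected margins are nearly right, the tables
have total weight at least `exp (-L)` with `L = K n log n` (`exists_blockMean`). The uniform law is
then the Bernoulli law conditioned on an event that is not too rare.

The top rows contain `J`, about `m W / k`, disjoint row segments of length `k` in a window of `W`
columns, all with the same law since rows and columns of equal margin are exchangeable. Jensen's
inequality and an exponential moment under the independent law show that one segment is within `4
√(L / J)` of independence (`sum_abs_sub_le_of_blocks`). With `W = m` and `W = n` this tends to `0`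
exactly in the stated ranges of `k`.

The lower bound `exp (-L)` is a count of tables. Balanced column sums maximise the number of tables
with given row sums (`card_tabs_le_of_balanced`), so by pigeonhole they receive at least a `(p + 1)
^ (-q)` share of all matrices with these row sums. This is applied to each of four blocks with
nearly constant margins, and the four tables are glued. -/

namespace BinaryContingency

/-! ### Counting tables: balanced margins and gluing of blocks. -/

/-- The finset of `p × q` binary contingency tables with row sums `a` and column sums `b`. -/
def tabs {p q : ℕ} (a : Fin p → ℕ) (b : Fin q → ℕ) : Finset (Fin p → Fin q → Fin 2) :=
  Finset.univ.filter fun d => (∀ i, ∑ j, (d i j : ℕ) = a i) ∧ ∀ j, ∑ i, (d i j : ℕ) = b j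

theorem mem_tabs {p q : ℕ} {a : Fin p → ℕ} {b : Fin q → ℕ} {d : Fin p → Fin q → Fin 2} :
    d ∈ tabs a b ↔ (∀ i, ∑ j, (d i j : ℕ) = a i) ∧ ∀ j, ∑ i, (d i j : ℕ) = b j := by
  simp [tabs]

theorem coe_tabs {p q : ℕ} (a : Fin p → ℕ) (b : Fin q → ℕ) :
    (tabs a b : Set (Fin p → Fin q → Fin 2)) = tables a b := by
  ext d; simp [tabs, tables]

theorem card_tabs_transpose {p q : ℕ} (a : Fin p → ℕ) (b : Fin q → ℕ) :
    (tabs a b).card = (tabs b a).card := by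
  refine Finset.card_bij' (fun d _ => fun j i => d i j) (fun d _ => fun j i => d i j)
    ?_ ?_ (fun _ _ => rfl) (fun _ _ => rfl)
  · intro d hd; rw [mem_tabs] at hd ⊢; exact ⟨hd.2, hd.1⟩
  · intro d hd; rw [mem_tabs] at hd ⊢; exact ⟨hd.2, hd.1⟩

/-- Interchange the entries in the columns `j` and `l` of row `i`. -/
def swapEntries {p q : ℕ} (j l : Fin q) (d : Fin p → Fin q → Fin 2) (i : Fin p) :
    Fin p → Fin q → Fin 2 :=
  Function.update d i (d i ∘ Equiv.swap j l)

theorem swapEntries_self {p q : ℕ} (j l : Fin q) (d : Fin p → Fin q → Fin 2) (i : Fin p) :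
    swapEntries j l d i i = d i ∘ Equiv.swap j l := by
  simp [swapEntries]

theorem swapEntries_of_ne {p q : ℕ} (j l : Fin q) (d : Fin p → Fin q → Fin 2) {i i' : Fin p}
    (h : i' ≠ i) : swapEntries j l d i i' = d i' := by
  simp [swapEntries, h]

theorem swapEntries_swapEntries {p q : ℕ} (j l : Fin q) (d : Fin p → Fin q → Fin 2) (i : Fin p) :
    swapEntries j l (swapEntries j l d i) i = d := by
  funext i' j'
  by_cases h : i' = i
  · subst h; simp [swapEntries_self]
  · simp [swapEntries_of_ne j l _ h]

/-- The rows in which `d` has entry `1` in column `j` and entry `0` in column `l`. -/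
def descents {p q : ℕ} (j l : Fin q) (d : Fin p → Fin q → Fin 2) : Finset (Fin p) :=
  Finset.univ.filter fun i => d i j = 1 ∧ d i l = 0

theorem mem_descents {p q : ℕ} {j l : Fin q} {d : Fin p → Fin q → Fin 2} {i : Fin p} :
    i ∈ descents j l d ↔ d i j = 1 ∧ d i l = 0 := by
  simp [descents]

/-- Rows in which the two entries agree cancel in the difference of the column sums. The additive
form avoids truncated subtraction. -/
theorem sum_add_card_descents {p q : ℕ} (j l : Fin q) (d : Fin p → Fin q → Fin 2) :
    ∑ i, (d i j : ℕ) + (descents l j d).card = ∑ i, (d i l : ℕ) + (descents j l d).card := by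
  simp only [descents, Finset.card_filter, ← Finset.sum_add_distrib]
  refine Finset.sum_congr rfl fun i _ => ?_
  generalize d i j = x
  generalize d i l = y
  revert x y; decide

/-- The swap turns exactly row `i` into a descent in the other direction; this makes the weights
match in the double count below. -/
theorem card_descents_swapEntries {p q : ℕ} {j l : Fin q}
    {d : Fin p → Fin q → Fin 2} {i : Fin p} (hi : i ∈ descents j l d) :
    (descents l j (swapEntries j l d i)).card = (descents l j d).card + 1 := by
  rw [mem_descents] at hi
  have h0 : i ∉ descents l j d := by
    rw [mem_descents, hi.1, hi.2]; decide
  rw [← Finset.card_insert_of_notMem h0]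
  congr 1
  ext i'
  rw [Finset.mem_insert, mem_descents, mem_descents]
  by_cases h : i' = i
  · subst h; simp [swapEntries_self, hi.1, hi.2]
  · simp [swapEntries_of_ne j l _ h, h]

theorem swapEntries_mem_tabs {p q : ℕ} {a : Fin p → ℕ} {b b' : Fin q → ℕ} {j l : Fin q}
    (hjl : j ≠ l) (hj : b' j + 1 = b j) (hl : b' l = b l + 1)
    (hb : ∀ x, x ≠ j → x ≠ l → b' x = b x)
    {d : Fin p → Fin q → Fin 2} (hd : d ∈ tabs a b) {i : Fin p} (hi : i ∈ descents j l d) :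
    swapEntries j l d i ∈ tabs a b' := by
  rw [mem_tabs] at hd ⊢
  rw [mem_descents] at hi
  refine ⟨fun i' => ?_, fun x => ?_⟩
  · rw [← hd.1 i']
    by_cases h : i' = i
    · subst h
      simp only [swapEntries_self, Function.comp]
      exact Equiv.sum_comp (Equiv.swap j l) fun x => (d i' x : ℕ)
    · simp [swapEntries_of_ne j l _ h]
  · have h1 : ∀ e : Fin p → Fin q → Fin 2, ∑ i', (e i' x : ℕ)
        = (e i x : ℕ) + ∑ i' ∈ Finset.univ.erase i, (e i' x : ℕ) := fun e =>
      (Finset.add_sum_erase _ _ (Finset.mem_univ i)).symm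
    have h2 : ∑ i' ∈ Finset.univ.erase i, (swapEntries j l d i i' x : ℕ)
        = ∑ i' ∈ Finset.univ.erase i, (d i' x : ℕ) :=
      Finset.sum_congr rfl fun i' hi' => by
        rw [swapEntries_of_ne j l _ (Finset.ne_of_mem_erase hi')]
    have h3 := hd.2 x
    rw [h1] at h3 ⊢
    rw [h2, swapEntries_self, Function.comp]
    by_cases hxj : x = j
    · subst hxj
      rw [Equiv.swap_apply_left, hi.2]
      rw [hi.1] at h3
      simp only [Fin.val_one, Fin.val_zero] at h3 ⊢
      omega
    · by_cases hxl : x = l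
      · subst hxl
        rw [Equiv.swap_apply_right, hi.1]
        rw [hi.2] at h3
        simp only [Fin.val_one, Fin.val_zero] at h3 ⊢
        omega
      · rw [Equiv.swap_apply_of_ne_of_ne hxj hxl, hb x hxj hxl]
        exact h3

/-- Moving a unit from a column to one with smaller sum does not decrease the number of tables. -/
theorem card_tabs_le_of_transfer {p q : ℕ} {a : Fin p → ℕ} {b b' : Fin q → ℕ} {j l : Fin q}
    (hlt : b l < b j) (hj : b' j + 1 = b j) (hl : b' l = b l + 1)
    (hb : ∀ x, x ≠ j → x ≠ l → b' x = b x) : (tabs a b).card ≤ (tabs a b').card := by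
  have hjl : j ≠ l := by rintro rfl; exact lt_irrefl _ hlt
  -- Weighted double counting of pairs (table, row to swap). Since `b l < b j`, a table has enough
  -- descents from `j` to `l` to send out mass at least `1`. The swap is a bijection of pairs, and
  -- each target receives mass at most `1`, the value being `0 / 0 = 0` if it has no such row.
  have key : ((tabs a b).card : ℚ) ≤ (tabs a b').card := by
    calc ((tabs a b).card : ℚ) = ∑ d ∈ tabs a b, (1 : ℚ) := by simp
      _ ≤ ∑ d ∈ tabs a b, ∑ i ∈ descents j l d, (1 / ((descents l j d).card + 1 : ℚ)) := by
        refine Finset.sum_le_sum fun d hd => ?_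
        rw [Finset.sum_const, nsmul_eq_mul, mul_one_div, le_div_iff₀ (by positivity), one_mul]
        have h := sum_add_card_descents j l d
        rw [mem_tabs] at hd
        rw [hd.2, hd.2] at h
        have : (descents l j d).card + 1 ≤ (descents j l d).card := by omega
        exact_mod_cast this
      _ = ∑ d ∈ tabs a b', ∑ i ∈ descents l j d, (1 / ((descents l j d).card : ℚ)) := by
        rw [Finset.sum_sigma', Finset.sum_sigma']
        refine Finset.sum_bij' (fun x _ => ⟨swapEntries j l x.1 x.2, x.2⟩)
          (fun x _ => ⟨swapEntries j l x.1 x.2, x.2⟩) ?_ ?_ ?_ ?_ ?_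
        · rintro ⟨d, i⟩ h
          rw [Finset.mem_sigma] at h ⊢
          refine ⟨swapEntries_mem_tabs hjl hj hl hb h.1 h.2, ?_⟩
          have := h.2
          rw [mem_descents] at this ⊢
          simpa [swapEntries_self] using this
        · rintro ⟨d, i⟩ h
          rw [Finset.mem_sigma] at h ⊢
          have hs : swapEntries j l d i = swapEntries l j d i := by
            rw [swapEntries, swapEntries, Equiv.swap_comm]
          refine ⟨?_, ?_⟩
          · simp only [hs]
            exact swapEntries_mem_tabs hjl.symm hl.symm hj.symm
              (fun x hx hx' => (hb x hx' hx).symm) h.1 h.2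
          · have := h.2
            rw [mem_descents] at this ⊢
            simpa [swapEntries_self] using this
        · rintro ⟨d, i⟩ _
          simp [swapEntries_swapEntries]
        · rintro ⟨d, i⟩ _
          simp [swapEntries_swapEntries]
        · rintro ⟨d, i⟩ h
          rw [Finset.mem_sigma] at h
          rw [card_descents_swapEntries h.2]
          push_cast; rfl
      _ ≤ ∑ d ∈ tabs a b', (1 : ℚ) := by
        refine Finset.sum_le_sum fun d _ => ?_
        rw [Finset.sum_const, nsmul_eq_mul, mul_one_div]
        exact div_self_le_one _
      _ = (tabs a b').card := by simp
  exact_mod_cast key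

/-- Balanced column sums maximise the number of tables. -/
theorem card_tabs_le_of_balanced {p q : ℕ} (a : Fin p → ℕ) {b₀ : Fin q → ℕ}
    (hb₀ : ∀ j l, b₀ j ≤ b₀ l + 1) (b : Fin q → ℕ) (hsum : ∑ j, b j = ∑ j, b₀ j) :
    (tabs a b).card ≤ (tabs a b₀).card := by
  -- Truncated subtraction makes this the total excess over `b₀`; each transfer lowers it.
  induction hN : ∑ j, (b j - b₀ j) using Nat.strong_induction_on generalizing b with
  | _ N ih =>
    by_cases hle : ∀ j, b j ≤ b₀ j
    · have : b = b₀ := by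
        funext j
        exact (Finset.sum_eq_sum_iff_of_le fun j _ => hle j).1 hsum j (Finset.mem_univ j)
      rw [this]
    · push Not at hle
      obtain ⟨j, hj⟩ := hle
      obtain ⟨l, hl⟩ : ∃ l, b l < b₀ l := by
        by_contra! h
        have := Finset.sum_lt_sum (s := Finset.univ) (fun i _ => h i) ⟨j, Finset.mem_univ j, hj⟩
        omega
      have hjl : j ≠ l := by rintro rfl; omega
      -- Balance gives `b l < b₀ l ≤ b₀ j + 1 ≤ b j`, so a unit may be moved from `j` to `l`.
      have h1 := hb₀ l j
      set b' : Fin q → ℕ := Function.update (Function.update b j (b j - 1)) l (b l + 1) with hb'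
      have e1 : b' j = b j - 1 := by simp [hb', hjl]
      have e2 : b' l = b l + 1 := by simp [hb']
      have e3 : ∀ x, x ≠ j → x ≠ l → b' x = b x := fun x hx hx' => by simp [hb', hx, hx']
      refine (card_tabs_le_of_transfer (j := j) (l := l) (b' := b') (by omega) (by omega) e2
        e3).trans (ih _ ?_ b' ?_ rfl)
      · rw [← hN]
        refine Finset.sum_lt_sum (fun x _ => ?_) ⟨j, Finset.mem_univ j, by omega⟩
        by_cases hx : x = j
        · subst hx; omega
        · by_cases hx' : x = l
          · subst hx'; omega
          · rw [e3 x hx hx']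
      · rw [← hsum]
        have split : ∀ f : Fin q → ℕ, ∑ x, f x
            = f j + (f l + ∑ x ∈ (Finset.univ.erase j).erase l, f x) := fun f => by
          rw [Finset.add_sum_erase _ _ (Finset.mem_erase.2 ⟨hjl.symm, Finset.mem_univ l⟩),
            Finset.add_sum_erase _ _ (Finset.mem_univ j)]
        have e4 : ∑ x ∈ (Finset.univ.erase j).erase l, b' x
            = ∑ x ∈ (Finset.univ.erase j).erase l, b x :=
          Finset.sum_congr rfl fun x hx => by
            simp only [Finset.mem_erase] at hx
            exact e3 x hx.2.1 hx.1
        rw [split, split b, e1, e2, e4]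
        omega

theorem card_filter_sum_eq {q : ℕ} (s : ℕ) :
    (Finset.univ.filter fun x : Fin q → Fin 2 => ∑ j, (x j : ℕ) = s).card = q.choose s := by
  have h : q.choose s = (Finset.powersetCard s (Finset.univ : Finset (Fin q))).card := by simp
  have hs : ∀ x : Fin q → Fin 2, ∑ j, (x j : ℕ) = (Finset.univ.filter fun j => x j = 1).card := by
    intro x
    rw [Finset.card_filter]
    refine Finset.sum_congr rfl fun j _ => ?_
    generalize x j = y
    revert y; decide
  rw [h]
  refine Finset.card_bij' (fun x _ => Finset.univ.filter fun j => x j = 1)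
    (fun S _ => fun j => if j ∈ S then 1 else 0) ?_ ?_ ?_ ?_
  · intro x hx
    simp only [Finset.mem_filter, Finset.mem_univ, true_and] at hx
    rw [Finset.mem_powersetCard]
    exact ⟨Finset.subset_univ _, by rw [← hs, hx]⟩
  · intro S hS
    rw [Finset.mem_powersetCard] at hS
    simp only [Finset.mem_filter, Finset.mem_univ, true_and]
    rw [hs, ← hS.2]
    congr 1
    ext j; simp
  · intro x _
    funext j
    simp only [Finset.mem_filter, Finset.mem_univ, true_and]
    generalize x j = y
    revert y; decide
  · intro S _
    ext j; simp

theorem card_rows {p q : ℕ} (a : Fin p → ℕ) :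
    (Finset.univ.filter fun d : Fin p → Fin q → Fin 2 => ∀ i, ∑ j, (d i j : ℕ) = a i).card
      = ∏ i, q.choose (a i) := by
  have : (Finset.univ.filter fun d : Fin p → Fin q → Fin 2 => ∀ i, ∑ j, (d i j : ℕ) = a i)
      = Fintype.piFinset fun i => Finset.univ.filter fun x : Fin q → Fin 2 =>
        ∑ j, (x j : ℕ) = a i := by
    ext d; simp
  rw [this, Fintype.card_piFinset]
  simp [card_filter_sum_eq]

/-- The number of tables with balanced column sums is at least the number of tables with the
given row sums divided by the number of conceivable column sums. -/
theorem prod_choose_le_card_tabs {p q : ℕ} (a : Fin p → ℕ) {b : Fin q → ℕ}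
    (hb : ∀ j l, b j ≤ b l + 1) (hsum : ∑ i, a i = ∑ j, b j) :
    ∏ i, q.choose (a i) ≤ (p + 1) ^ q * (tabs a b).card := by
  rw [← card_rows a]
  set R := Finset.univ.filter fun d : Fin p → Fin q → Fin 2 => ∀ i, ∑ j, (d i j : ℕ) = a i with hR
  set f : (Fin p → Fin q → Fin 2) → Fin q → ℕ := fun d j => ∑ i, (d i j : ℕ) with hf
  have h1 : (R.image f).card ≤ (p + 1) ^ q := by
    have : R.image f ⊆ Fintype.piFinset fun _ => Finset.range (p + 1) := by
      intro x hx
      rw [Finset.mem_image] at hx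
      obtain ⟨d, -, rfl⟩ := hx
      rw [Fintype.mem_piFinset]
      intro j
      rw [Finset.mem_range, Nat.lt_succ_iff]
      calc f d j ≤ ∑ _i : Fin p, 1 := Finset.sum_le_sum fun i _ => by omega
        _ = p := by simp
    refine (Finset.card_le_card this).trans ?_
    simp
  -- A fibre consists of tables whose column sums have the same total as `b`, so the balanced count
  -- bounds it.
  have h2 : ∀ x ∈ R.image f, (R.filter fun d => f d = x).card ≤ (tabs a b).card := by
    intro x hx
    rw [Finset.mem_image] at hx
    obtain ⟨d, hd, rfl⟩ := hx
    have : (R.filter fun e => f e = f d) ⊆ tabs a (f d) := by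
      intro e he
      simp only [hR, Finset.mem_filter, Finset.mem_univ, true_and] at he
      rw [mem_tabs]
      exact ⟨he.1, fun j => congrFun he.2 j⟩
    refine (Finset.card_le_card this).trans (card_tabs_le_of_balanced a hb _ ?_)
    simp only [hR, Finset.mem_filter, Finset.mem_univ, true_and] at hd
    rw [← hsum, hf, Finset.sum_comm]
    exact Finset.sum_congr rfl fun i _ => hd i
  have h3 := Finset.card_le_mul_card_image (f := f) R _ h2
  calc R.card ≤ (tabs a b).card * (R.image f).card := h3
    _ ≤ (tabs a b).card * (p + 1) ^ q := Nat.mul_le_mul_left _ h1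
    _ = _ := mul_comm _ _

/-- Existence comes from the count: the product of binomial coefficients is positive. -/
theorem card_tabs_pos {p q : ℕ} {a : Fin p → ℕ} {b : Fin q → ℕ} (ha : ∀ i, a i ≤ q)
    (hb : ∀ j l, b j ≤ b l + 1) (hsum : ∑ i, a i = ∑ j, b j) : 0 < (tabs a b).card := by
  have h := prod_choose_le_card_tabs a hb hsum
  have h' : 0 < ∏ i, q.choose (a i) := Finset.prod_pos fun i _ => Nat.choose_pos (ha i)
  exact Nat.pos_of_mul_pos_left (h'.trans_le h)

/-- The table with the four given blocks. -/
def glue {p p' q q' : ℕ} (A : Fin p → Fin q → Fin 2) (B : Fin p → Fin q' → Fin 2)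
    (C : Fin p' → Fin q → Fin 2) (D : Fin p' → Fin q' → Fin 2) :
    Fin (p + p') → Fin (q + q') → Fin 2 :=
  Fin.append (fun i => Fin.append (A i) (B i)) (fun i => Fin.append (C i) (D i))

/-- Gluing four tables is injective and adds the margins of adjacent blocks. -/
theorem card_tabs_blocks {p p' q q' : ℕ} (r₁₁ r₁₂ : Fin p → ℕ) (r₂₁ r₂₂ : Fin p' → ℕ)
    (c₁₁ c₂₁ : Fin q → ℕ) (c₁₂ c₂₂ : Fin q' → ℕ) :
    (tabs r₁₁ c₁₁).card * (tabs r₁₂ c₁₂).card * (tabs r₂₁ c₂₁).card * (tabs r₂₂ c₂₂).card ≤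
      (tabs (Fin.append (r₁₁ + r₁₂) (r₂₁ + r₂₂)) (Fin.append (c₁₁ + c₂₁) (c₁₂ + c₂₂))).card := by
  rw [← Finset.card_product, ← Finset.card_product, ← Finset.card_product]
  refine Finset.card_le_card_of_injOn (fun x => glue x.1.1.1 x.1.1.2 x.1.2 x.2) ?_ ?_
  · rintro ⟨⟨⟨A, B⟩, C⟩, D⟩ h
    simp only [Finset.coe_product, Set.mem_prod, Finset.mem_coe, mem_tabs] at h ⊢
    obtain ⟨⟨⟨hA, hB⟩, hC⟩, hD⟩ := h
    refine ⟨fun i => ?_, fun j => ?_⟩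
    · refine Fin.addCases (fun i => ?_) (fun i => ?_) i
      · simp [glue, Fin.sum_univ_add, hA.1, hB.1]
      · simp [glue, Fin.sum_univ_add, hC.1, hD.1]
    · refine Fin.addCases (fun j => ?_) (fun j => ?_) j
      · simp [glue, Fin.sum_univ_add, hA.2, hC.2]
      · simp [glue, Fin.sum_univ_add, hB.2, hD.2]
  · rintro ⟨⟨⟨A, B⟩, C⟩, D⟩ _ ⟨⟨⟨A', B'⟩, C'⟩, D'⟩ _ h
    have e : ∀ i j, glue A B C D i j = glue A' B' C' D' i j := fun i j => by
      exact congrFun (congrFun h i) j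
    have hA : A = A' := by
      funext i j; simpa [glue] using e (Fin.castAdd _ i) (Fin.castAdd _ j)
    have hB : B = B' := by
      funext i j; simpa [glue] using e (Fin.castAdd _ i) (Fin.natAdd _ j)
    have hC : C = C' := by
      funext i j; simpa [glue] using e (Fin.natAdd _ i) (Fin.castAdd _ j)
    have hD : D = D' := by
      funext i j; simpa [glue] using e (Fin.natAdd _ i) (Fin.natAdd _ j)
    rw [hA, hB, hC, hD]

/-! ### Estimates for binomial probabilities. -/

open Nat in
-- The terms `s ^ j / j !` of the exponential series at `s` are largest at `j = s`.
theorem factorial_mul_pow_le (s j : ℕ) : s ! * s ^ j ≤ j ! * s ^ s := by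
  rcases le_total s j with h | h
  · have := Nat.factorial_mul_pow_sub_le_factorial h
    calc s ! * s ^ j = s ! * s ^ (j - s) * s ^ s := by
          rw [mul_assoc, ← pow_add, Nat.sub_add_cancel h]
      _ ≤ _ := Nat.mul_le_mul_right _ this
  · have h1 := Nat.factorial_mul_descFactorial (n := s) (k := s - j) (Nat.sub_le _ _)
    rw [Nat.sub_sub_self h] at h1
    calc s ! * s ^ j = j ! * s.descFactorial (s - j) * s ^ j := by rw [h1]
      _ ≤ j ! * s ^ (s - j) * s ^ j := by
          gcongr; exact Nat.descFactorial_le_pow _ _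
      _ = j ! * s ^ s := by rw [mul_assoc, ← pow_add, Nat.sub_add_cancel h]

/-- The mode of the binomial distribution with parameters `n` and `s / n` is `s`. -/
theorem choose_mul_pow_le {n s j : ℕ} (hs : s ≤ n) (hj : j ≤ n) :
    n.choose j * (s ^ j * (n - s) ^ (n - j)) ≤ n.choose s * (s ^ s * (n - s) ^ (n - s)) := by
  have h1 := factorial_mul_pow_le s j
  have h2 := factorial_mul_pow_le (n - s) (n - j)
  have h3 := Nat.mul_le_mul h1 h2
  have e1 := Nat.choose_mul_factorial_mul_factorial hj
  have e2 := Nat.choose_mul_factorial_mul_factorial hs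
  have hpos : 0 < (j.factorial * (n - j).factorial) * (s.factorial * (n - s).factorial) := by
    positivity
  refine Nat.le_of_mul_le_mul_right ?_ hpos
  calc n.choose j * (s ^ j * (n - s) ^ (n - j)) *
        ((j.factorial * (n - j).factorial) * (s.factorial * (n - s).factorial))
      = (n.choose j * j.factorial * (n - j).factorial) *
        (s.factorial * s ^ j * ((n - s).factorial * (n - s) ^ (n - j))) := by ring
    _ ≤ (n.choose j * j.factorial * (n - j).factorial) *
        (j.factorial * s ^ s * ((n - j).factorial * (n - s) ^ (n - s))) := by gcongr
    _ = (n.choose s * s.factorial * (n - s).factorial) *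
        (j.factorial * s ^ s * ((n - j).factorial * (n - s) ^ (n - s))) := by rw [e1, e2]
    _ = _ := by ring

/-- The probability that a binomial variable with parameters `n` and `z` is `j`. -/
noncomputable def binomialWeight (n : ℕ) (z : ℝ) (j : ℕ) : ℝ :=
  n.choose j * (z ^ j * (1 - z) ^ (n - j))

theorem sum_binomialWeight (n : ℕ) (z : ℝ) :
    ∑ j ∈ Finset.range (n + 1), binomialWeight n z j = 1 := by
  have h := add_pow z (1 - z) n
  rw [add_sub_cancel, one_pow] at h
  rw [h]
  exact Finset.sum_congr rfl fun j _ => by rw [binomialWeight]; ring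

theorem binomialWeight_le_mode {n s : ℕ} (hs : s ≤ n) (j : ℕ) :
    binomialWeight n (s / n) j ≤ binomialWeight n (s / n) s := by
  rcases Nat.eq_zero_or_pos n with rfl | hn
  · obtain rfl : s = 0 := by omega
    rcases Nat.eq_zero_or_pos j with rfl | hj
    · exact le_rfl
    · simp [binomialWeight, Nat.choose_eq_zero_of_lt hj]
  have hn' : (0 : ℝ) < n := by exact_mod_cast hn
  have key : ∀ i ≤ n, binomialWeight n (s / n) i
      = ((n.choose i * (s ^ i * (n - s) ^ (n - i)) : ℕ) : ℝ) / n ^ n := by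
    intro i hi
    have h1 : (1 : ℝ) - s / n = ((n - s : ℕ) : ℝ) / n := by
      rw [Nat.cast_sub hs]; field_simp
    rw [binomialWeight, h1, div_pow, div_pow]
    have h2 : (n : ℝ) ^ n = n ^ i * n ^ (n - i) := by rw [← pow_add, Nat.add_sub_cancel' hi]
    rw [h2]
    push_cast
    field_simp
  rcases le_or_gt j n with hj | hj
  · rw [key j hj, key s hs]
    exact div_le_div_of_nonneg_right (by exact_mod_cast choose_mul_pow_le hs hj) (by positivity)
  · rw [binomialWeight, Nat.choose_eq_zero_of_lt hj, key s hs]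
    simp only [Nat.cast_zero, zero_mul]
    positivity

/-- The `n + 1` weights sum to `1`, so the largest is at least their average. -/
theorem one_le_mode {n s : ℕ} (hs : s ≤ n) : 1 ≤ (n + 1) * binomialWeight n (s / n) s := by
  calc (1 : ℝ) = ∑ j ∈ Finset.range (n + 1), binomialWeight n (s / n) j :=
        (sum_binomialWeight n _).symm
    _ ≤ ∑ _j ∈ Finset.range (n + 1), binomialWeight n (s / n) s :=
        Finset.sum_le_sum fun j _ => binomialWeight_le_mode hs j
    _ = _ := by simp

/-- This is `t ≤ exp (t - 1)` at `t = p / z`. It serves to replace the empirical frequency `p` by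
another success parameter `z`. -/
theorem mul_exp_le {p z : ℝ} (hz : 0 < z) : p * Real.exp (1 - p / z) ≤ z := by
  have h1 : p / z ≤ Real.exp (p / z - 1) := by
    have := Real.add_one_le_exp (p / z - 1); linarith
  calc p * Real.exp (1 - p / z) = z * (p / z * Real.exp (1 - p / z)) := by field_simp
    _ ≤ z * (Real.exp (p / z - 1) * Real.exp (1 - p / z)) := by gcongr
    _ = z := by rw [← Real.exp_add]; simp

/-- A lower bound for the binomial probabilities. -/
theorem exp_le_binomialWeight {n s : ℕ} (hs : s ≤ n) {z : ℝ} (hz : 0 < z) (hz1 : z < 1) :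
    Real.exp (-((s - n * z) ^ 2 / (n * (z * (1 - z))))) ≤ (n + 1) * binomialWeight n z s := by
  rcases Nat.eq_zero_or_pos n with rfl | hn
  · obtain rfl : s = 0 := by omega
    simp [binomialWeight]
  have hn' : (0 : ℝ) < n := by exact_mod_cast hn
  have hz2 : 0 < 1 - z := by linarith
  set p : ℝ := s / n with hp
  have hp0 : 0 ≤ p := by positivity
  have hp1 : p ≤ 1 := by
    rw [hp, div_le_one hn']; exact_mod_cast hs
  -- The exponents lost on successes and on failures add up to minus the chi-square distance of `p`
  -- from `z`.
  have e : -((s - n * z) ^ 2 / (n * (z * (1 - z))))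
      = s * (1 - p / z) + (n - s : ℕ) * (1 - (1 - p) / (1 - z)) := by
    rw [Nat.cast_sub hs, hp]
    field_simp
    ring
  have h1 : p ^ s * Real.exp (s * (1 - p / z)) ≤ z ^ s := by
    rw [Real.exp_nat_mul, ← mul_pow]
    exact pow_le_pow_left₀ (by positivity) (mul_exp_le hz) _
  have h2 : (1 - p) ^ (n - s) * Real.exp ((n - s : ℕ) * (1 - (1 - p) / (1 - z)))
      ≤ (1 - z) ^ (n - s) := by
    rw [Real.exp_nat_mul, ← mul_pow]
    exact pow_le_pow_left₀ (mul_nonneg (by linarith) (Real.exp_nonneg _)) (mul_exp_le hz2) _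
  rw [e, Real.exp_add]
  calc Real.exp (s * (1 - p / z)) * Real.exp ((n - s : ℕ) * (1 - (1 - p) / (1 - z)))
      = 1 * (Real.exp (s * (1 - p / z)) * Real.exp ((n - s : ℕ) * (1 - (1 - p) / (1 - z)))) := by
        ring
    _ ≤ ((n + 1) * binomialWeight n p s) *
        (Real.exp (s * (1 - p / z)) * Real.exp ((n - s : ℕ) * (1 - (1 - p) / (1 - z)))) := by
        gcongr; exact one_le_mode hs
    _ = (n + 1) * (n.choose s * ((p ^ s * Real.exp (s * (1 - p / z))) *
          ((1 - p) ^ (n - s) * Real.exp ((n - s : ℕ) * (1 - (1 - p) / (1 - z)))))) := by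
        rw [binomialWeight]; ring
    _ ≤ (n + 1) * (n.choose s * (z ^ s * (1 - z) ^ (n - s))) := by
        gcongr
    _ = _ := by rw [binomialWeight]

/-- Adding the two absorption identities `h1` and `h2` writes `(n + 1)` times a weight for `n`
trials as a combination of two weights for `n + 1` trials, with coefficients `j + 1` and `n + 1 - j`
of sum `n + 2`. -/
theorem binomialWeight_le_of_succ {n : ℕ} {p M : ℝ}
    (hM : ∀ j, binomialWeight (n + 1) p j ≤ M) (j : ℕ) :
    binomialWeight n p j * (n + 1) ≤ M * (n + 2) := by
  have hM0 : 0 ≤ M := by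
    have := hM (n + 2)
    simpa [binomialWeight, Nat.choose_eq_zero_of_lt] using this
  rcases le_or_gt j n with hj | hj
  · have h1 : binomialWeight (n + 1) p (j + 1) * (j + 1) = binomialWeight n p j * (n + 1) * p := by
      have : ((n + 1 : ℕ) : ℝ) * (n.choose j : ℝ) = ((n + 1).choose (j + 1) : ℝ) * ((j + 1 : ℕ) : ℝ) := by
        exact_mod_cast Nat.add_one_mul_choose_eq n j
      rw [binomialWeight, binomialWeight, Nat.add_sub_add_right, pow_succ]
      push_cast at this
      linear_combination (-(p ^ j * p * (1 - p) ^ (n - j))) * this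
    have h2 : binomialWeight (n + 1) p j * (n + 1 - j)
        = binomialWeight n p j * (n + 1) * (1 - p) := by
      have : (n.choose j : ℝ) * ((n + 1 : ℕ) : ℝ) = ((n + 1).choose j : ℝ) * ((n + 1 - j : ℕ) : ℝ) := by
        exact_mod_cast Nat.choose_mul_succ_eq n j
      rw [Nat.cast_sub (by omega)] at this
      rw [binomialWeight, binomialWeight, Nat.succ_sub hj, pow_succ]
      push_cast at this
      linear_combination (-(p ^ j * (1 - p) ^ (n - j) * (1 - p))) * this
    have hj' : (j : ℝ) ≤ n := by exact_mod_cast hj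
    have h3 := mul_le_mul_of_nonneg_right (hM (j + 1)) (show (0 : ℝ) ≤ j + 1 by positivity)
    have h4 := mul_le_mul_of_nonneg_right (hM j) (show (0 : ℝ) ≤ n + 1 - j by linarith)
    linarith
  · rw [binomialWeight, Nat.choose_eq_zero_of_lt hj]
    simp only [Nat.cast_zero, zero_mul]
    positivity

theorem binomialWeight_le_of_add {n k : ℕ} {p M : ℝ}
    (hM : ∀ j, binomialWeight (n + k) p j ≤ M) (j : ℕ) :
    binomialWeight n p j * (n + 1) ≤ M * (n + k + 1) := by
  induction k generalizing M with
  | zero =>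
    have := hM j
    simp only [Nat.cast_zero, add_zero]
    gcongr
    exact this
  | succ k ih =>
    have h := ih (M := M * ((n + k + 2) / (n + k + 1))) fun j => by
      have := binomialWeight_le_of_succ (n := n + k) hM j
      push_cast at this
      rw [← mul_div_assoc, le_div_iff₀ (by positivity)]
      exact this
    calc _ ≤ _ := h
      _ = _ := by push_cast; field_simp; ring

/-- Sampling without replacement is dominated by sampling with replacement. -/
theorem choose_mul_le_of_sampling {n k s t : ℕ} (hs : s ≤ n) (hk : k ≤ n) (ht : t ≤ s)
    (htk : t ≤ k) :
    ((n - k).choose (s - t) : ℝ) * (n - k + 1) ≤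
      n.choose s * ((n + 1) * ((s / n : ℝ) ^ t * (1 - s / n) ^ (k - t))) := by
  set p : ℝ := s / n with hp
  have hp0 : 0 ≤ p := by positivity
  have hp1 : p ≤ 1 := div_le_one_of_le₀ (by exact_mod_cast hs) (by positivity)
  have hp2 : 0 ≤ 1 - p := by linarith
  have hmode := one_le_mode hs
  rw [← hp] at hmode
  -- Positivity at the mode also covers `s = 0` and `s = n`, where `0 ^ 0 = 1`; it permits
  -- cancelling `p ^ s * (1 - p) ^ (n - s)`.
  have hpos : 0 < binomialWeight n p s := by
    by_contra! h
    have : ((n : ℝ) + 1) * binomialWeight n p s ≤ 0 :=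
      mul_nonpos_of_nonneg_of_nonpos (by positivity) h
    linarith
  have hpp : 0 < p ^ s * (1 - p) ^ (n - s) := by
    rw [binomialWeight] at hpos
    exact pos_of_mul_pos_right hpos (by positivity)
  rcases le_or_gt (s - t) (n - k) with hst | hst
  · have h := binomialWeight_le_of_add (n := n - k) (k := k) (p := p)
      (M := binomialWeight n p s) (fun j => by
        rw [Nat.sub_add_cancel hk]; exact binomialWeight_le_mode hs j) (s - t)
    rw [Nat.cast_sub hk] at h
    have e1 : p ^ s = p ^ (s - t) * p ^ t := by rw [← pow_add, Nat.sub_add_cancel ht]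
    have e2 : (1 - p) ^ (n - s) = (1 - p) ^ (n - k - (s - t)) * (1 - p) ^ (k - t) := by
      rw [← pow_add]; congr 1; omega
    refine le_of_mul_le_mul_right ?_ hpp
    calc ((n - k).choose (s - t) : ℝ) * (n - k + 1) * (p ^ s * (1 - p) ^ (n - s))
        = binomialWeight (n - k) p (s - t) * (n - k + 1) * (p ^ t * (1 - p) ^ (k - t)) := by
          rw [e1, e2, binomialWeight]; ring
      _ ≤ binomialWeight n p s * (n - k + k + 1) * (p ^ t * (1 - p) ^ (k - t)) := by gcongr
      _ = _ := by rw [binomialWeight]; ring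
  · rw [Nat.choose_eq_zero_of_lt hst]
    simp only [Nat.cast_zero, zero_mul]
    positivity

/-! ### Total variation and products of Bernoulli weights. -/

/-- A one-sided bound suffices: the positive part of `P - Q` is at most `ε * Q`, and `P - Q` has sum
zero, so the negative part has the same mass. -/
theorem sum_abs_sub_le_of_le_mul {α : Type*} [Fintype α] {P Q : α → ℝ} (hQ : ∀ x, 0 ≤ Q x)
    (hPs : ∑ x, P x = 1) (hQs : ∑ x, Q x = 1) {ε : ℝ} (hε : 0 ≤ ε)
    (h : ∀ x, P x ≤ (1 + ε) * Q x) : ∑ x, |P x - Q x| ≤ 2 * ε := by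
  calc ∑ x, |P x - Q x| ≤ ∑ x, (2 * ε * Q x - (P x - Q x)) := by
        refine Finset.sum_le_sum fun x _ => ?_
        have h1 := h x
        have h2 := mul_nonneg hε (hQ x)
        rw [abs_le]
        constructor <;> nlinarith
    _ = 2 * ε := by
        rw [Finset.sum_sub_distrib, Finset.sum_sub_distrib, ← Finset.mul_sum, hPs, hQs]; ring

/-- The weights of the Bernoulli law with mean `z`. -/
noncomputable def berWeight (z : ℝ) (x : Fin 2) : ℝ := if x = 1 then z else 1 - z

theorem berWeight_nonneg {z : ℝ} (hz : 0 ≤ z) (hz1 : z ≤ 1) (x : Fin 2) : 0 ≤ berWeight z x := by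
  rw [berWeight]; split_ifs <;> linarith

theorem sum_berWeight (z : ℝ) : ∑ x, berWeight z x = 1 := by
  simp [berWeight]

theorem sum_prod_berWeight (κ : Type*) [Fintype κ] [DecidableEq κ] (z : κ → ℝ) :
    ∑ x : κ → Fin 2, ∏ s, berWeight (z s) (x s) = 1 := by
  rw [← Fintype.prod_sum]
  exact Finset.prod_eq_one fun s _ => sum_berWeight (z s)

theorem prod_berWeight {k : ℕ} (z : ℝ) (x : Fin k → Fin 2) :
    ∏ s, berWeight z (x s) = z ^ (∑ s, (x s : ℕ)) * (1 - z) ^ (k - ∑ s, (x s : ℕ)) := by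
  have h : ∀ y : Fin 2, berWeight z y = z ^ (y : ℕ) * (1 - z) ^ (1 - (y : ℕ)) := by
    intro y
    fin_cases y <;> simp [berWeight]
  simp_rw [h, Finset.prod_mul_distrib, Finset.prod_pow_eq_pow_sum]
  congr 2
  rw [eq_tsub_iff_add_eq_of_le, ← Finset.sum_add_distrib]
  · calc ∑ s, (1 - (x s : ℕ) + (x s : ℕ)) = ∑ _s : Fin k, 1 :=
        Finset.sum_congr rfl fun s _ => by omega
      _ = k := by simp
  · calc ∑ s, (x s : ℕ) ≤ ∑ _s : Fin k, 1 := Finset.sum_le_sum fun s _ => by omega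
      _ = k := by simp

/-- The coordinates are exchanged one at a time, each at a cost of `2 * |z - z'|`. -/
theorem sum_abs_prod_berWeight_sub_le {z z' : ℝ} (hz : 0 ≤ z) (hz1 : z ≤ 1) (hz' : 0 ≤ z')
    (hz1' : z' ≤ 1) (k : ℕ) :
    ∑ x : Fin k → Fin 2, |∏ s, berWeight z (x s) - ∏ s, berWeight z' (x s)|
      ≤ 2 * k * |z - z'| := by
  induction k with
  | zero => simp
  | succ k ih =>
    rw [← (Fin.consEquiv fun _ => Fin 2).sum_comp, Fintype.sum_prod_type]
    simp only [Fin.consEquiv_apply, Fin.prod_univ_succ, Fin.cons_zero, Fin.cons_succ]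
    have hb : ∀ a : Fin 2, |berWeight z a - berWeight z' a| = |z - z'| := by
      intro a
      rw [berWeight, berWeight]
      split_ifs
      · rfl
      · rw [abs_sub_comm]; congr 1; ring
    calc ∑ a : Fin 2, ∑ x : Fin k → Fin 2,
          |berWeight z a * ∏ s, berWeight z (x s) - berWeight z' a * ∏ s, berWeight z' (x s)|
        ≤ ∑ a : Fin 2, ∑ x : Fin k → Fin 2,
          (berWeight z a * |∏ s, berWeight z (x s) - ∏ s, berWeight z' (x s)| +
            |z - z'| * ∏ s, berWeight z' (x s)) := by
          refine Finset.sum_le_sum fun a _ => Finset.sum_le_sum fun x _ => ?_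
          rw [← abs_of_nonneg (berWeight_nonneg hz hz1 a), ← abs_mul, ← hb a,
            ← abs_of_nonneg (Finset.prod_nonneg fun s _ => berWeight_nonneg hz' hz1' (x s)),
            ← abs_mul, abs_of_nonneg (berWeight_nonneg hz hz1 a),
            abs_of_nonneg (Finset.prod_nonneg fun s _ => berWeight_nonneg hz' hz1' (x s))]
          refine le_trans (le_of_eq ?_) (abs_add_le _ _)
          congr 1; ring
      _ = ∑ x : Fin k → Fin 2, |∏ s, berWeight z (x s) - ∏ s, berWeight z' (x s)|
            + 2 * |z - z'| := by
          simp_rw [Finset.sum_add_distrib, ← Finset.mul_sum]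
          rw [sum_prod_berWeight (Fin k) fun _ => z', ← Finset.sum_mul, sum_berWeight]
          simp [mul_comm]
      _ ≤ 2 * k * |z - z'| + 2 * |z - z'| := by gcongr
      _ = _ := by push_cast; ring

/-- A random table with independent Bernoulli entries of mean `z` has given row sums and given
balanced column sums with at least this probability. -/
theorem exp_le_card_tabs_mul {p q : ℕ} {a : Fin p → ℕ} {b : Fin q → ℕ} (ha : ∀ i, a i ≤ q)
    (hb : ∀ j l, b j ≤ b l + 1) (hsum : ∑ i, a i = ∑ j, b j) {z : ℝ} (hz : 0 < z) (hz1 : z < 1) :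
    Real.exp (-∑ i, (a i - q * z) ^ 2 / (q * (z * (1 - z)))) ≤
      ((p : ℝ) + 1) ^ q * (q + 1) ^ p *
        ((tabs a b).card * (z ^ (∑ i, a i) * (1 - z) ^ (p * q - ∑ i, a i))) := by
  have hz2 : 0 < 1 - z := by linarith
  have e1 : p * q - ∑ i, a i = ∑ i, (q - a i) := by
    have : ∑ i, (q - a i) + ∑ i, a i = p * q := by
      rw [← Finset.sum_add_distrib, Finset.sum_congr rfl fun i _ => Nat.sub_add_cancel (ha i)]
      simp
    omega
  have e2 : ((∏ i, q.choose (a i) : ℕ) : ℝ) ≤ ((p : ℝ) + 1) ^ q * (tabs a b).card := by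
    exact_mod_cast prod_choose_le_card_tabs a hb hsum
  rw [← Finset.sum_neg_distrib, Real.exp_sum]
  -- With independent entries, the row sums are independent binomials and the factors are their
  -- probabilities. The correct column sums are then imposed at a cost of `(p + 1) ^ q`.
  calc ∏ i, Real.exp (-((a i - q * z) ^ 2 / (q * (z * (1 - z)))))
      ≤ ∏ i, (((q : ℝ) + 1) * binomialWeight q z (a i)) :=
        Finset.prod_le_prod (fun _ _ => (Real.exp_pos _).le)
          fun i _ => exp_le_binomialWeight (ha i) hz hz1
    _ = ((q : ℝ) + 1) ^ p * ((∏ i, q.choose (a i) : ℕ) *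
          (z ^ (∑ i, a i) * (1 - z) ^ (p * q - ∑ i, a i))) := by
        rw [e1]
        simp only [binomialWeight, Finset.prod_mul_distrib, Finset.prod_const, Finset.card_univ,
          Fintype.card_fin, Finset.prod_pow_eq_pow_sum]
        push_cast; rfl
    _ ≤ ((q : ℝ) + 1) ^ p * ((((p : ℝ) + 1) ^ q * (tabs a b).card) *
          (z ^ (∑ i, a i) * (1 - z) ^ (p * q - ∑ i, a i))) := by gcongr
    _ = _ := by ring

/-! ### Comparison with a product law through many disjoint blocks. -/

/-- Functions of disjoint groups of independent entries are independent, so the expectation factors.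
The entries outside the range of `Φ` contribute total weight `1`. -/
theorem sum_prod_berWeight_mul_prod {E ι κ : Type*} [Fintype E] [DecidableEq E] [Fintype ι]
    [DecidableEq ι] [Fintype κ] [DecidableEq κ] (w : E → ℝ) (Φ : ι × κ ↪ E) {z : ℝ}
    (hw : ∀ x, w (Φ x) = z) (g : (κ → Fin 2) → ℝ) :
    ∑ X : E → Fin 2, (∏ e, berWeight (w e) (X e)) * ∏ t, g (fun s => X (Φ (t, s)))
      = (∑ y : κ → Fin 2, (∏ s, berWeight z (y s)) * g y) ^ Fintype.card ι := by
  classical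
  let R := ((Set.range Φ)ᶜ : Set E)
  let e : (ι × κ) ⊕ R ≃ E :=
    (Equiv.sumCongr (Equiv.ofInjective Φ Φ.injective) (Equiv.refl _)).trans
      (Equiv.Set.sumCompl (Set.range Φ))
  have he : ∀ x, e (Sum.inl x) = Φ x := fun x => Equiv.Set.sumCompl_apply_inl _ _
  have hX : ∀ (F : (ι × κ) ⊕ R → Fin 2) y, (e.arrowCongr (Equiv.refl (Fin 2))) F (e y) = F y :=
    fun F y => by simp
  rw [← ((e.arrowCongr (Equiv.refl (Fin 2))).sum_comp),
    ← ((Equiv.sumArrowEquivProdArrow (ι × κ) R (Fin 2)).symm.sum_comp), Fintype.sum_prod_type,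
    ← ((Equiv.curry ι κ (Fin 2)).symm.sum_comp)]
  have h1 : ∀ (Y : ι → κ → Fin 2) (V : R → Fin 2),
      (∏ x, berWeight (w x) ((e.arrowCongr (Equiv.refl (Fin 2)))
        ((Equiv.sumArrowEquivProdArrow (ι × κ) R (Fin 2)).symm
          ((Equiv.curry ι κ (Fin 2)).symm Y, V)) x))
        = (∏ t, ∏ s, berWeight z (Y t s)) * ∏ r, berWeight (w (e (Sum.inr r))) (V r) := by
    intro Y V
    rw [← e.prod_comp, Fintype.prod_sum_type, Fintype.prod_prod_type]
    simp only [hX]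
    simp only [he, hw]
    rfl
  have h2 : ∀ (Y : ι → κ → Fin 2) (V : R → Fin 2) (t : ι),
      (fun s => ((e.arrowCongr (Equiv.refl (Fin 2)))
        ((Equiv.sumArrowEquivProdArrow (ι × κ) R (Fin 2)).symm
          ((Equiv.curry ι κ (Fin 2)).symm Y, V))) (Φ (t, s))) = Y t := by
    intro Y V t
    funext s
    rw [← he, hX]
    rfl
  simp only [h1, h2]
  calc ∑ Y : ι → κ → Fin 2, ∑ V : R → Fin 2,
        ((∏ t, ∏ s, berWeight z (Y t s)) * ∏ r, berWeight (w (e (Sum.inr r))) (V r)) * ∏ t, g (Y t)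
      = ∑ Y : ι → κ → Fin 2, (∏ t, (∏ s, berWeight z (Y t s)) * g (Y t)) *
          ∑ V : R → Fin 2, ∏ r, berWeight (w (e (Sum.inr r))) (V r) := by
        refine Finset.sum_congr rfl fun Y _ => ?_
        rw [Finset.mul_sum, Finset.prod_mul_distrib]
        exact Finset.sum_congr rfl fun V _ => by ring
    _ = ∑ Y : ι → κ → Fin 2, ∏ t, (∏ s, berWeight z (Y t s)) * g (Y t) := by
        rw [sum_prod_berWeight]; simp
    _ = _ := by
        rw [← Fintype.prod_sum (fun (_ : ι) (y : κ → Fin 2) => (∏ s, berWeight z (y s)) * g y)]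
        simp

/-- If a product of Bernoulli laws gives the same weight `c₀` to all points of a set `M`, with
total weight at least `exp (-L)`, then under the uniform law on `M` the probability of an event
in one of many disjoint equidistributed blocks is close to its probability under the product. -/
theorem mul_sub_le_of_blocks {Ω E ι κ : Type*} [Fintype Ω] [Fintype E] [DecidableEq E] [Fintype ι]
    [DecidableEq ι] [Fintype κ] [DecidableEq κ] (X : Ω → E → Fin 2) (hX : Function.Injective X)
    (M : Finset Ω) (hM : M.Nonempty) (w : E → ℝ) (hw0 : ∀ e, 0 ≤ w e) (hw1 : ∀ e, w e ≤ 1)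
    {c₀ L : ℝ} (hc₀ : 0 < c₀) (hc : ∀ ω ∈ M, ∏ e, berWeight (w e) (X ω e) = c₀)
    (hL : Real.exp (-L) ≤ M.card * c₀)
    (Φ : ι × κ ↪ E) {z : ℝ} (hz : ∀ x, w (Φ x) = z) (hz0 : 0 ≤ z) (hz1 : z ≤ 1)
    (A : Finset (κ → Fin 2)) {u : ℝ}
    (hu : ∀ t, ((M.filter fun ω => (fun s => X ω (Φ (t, s))) ∈ A).card : ℝ) = M.card * u)
    {l : ℝ} (hl0 : 0 ≤ l) (hl1 : l ≤ 1) :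
    Fintype.card ι * (l * (u - ∑ y ∈ A, ∏ s, berWeight z (y s)))
      ≤ L + Fintype.card ι * l ^ 2 := by
  classical
  set J := Fintype.card ι
  set Q := ∑ y ∈ A, ∏ s, berWeight z (y s) with hQ
  have hMc : (0 : ℝ) < M.card := by exact_mod_cast hM.card_pos
  set g : (κ → Fin 2) → ℝ := fun y => Real.exp (l * if y ∈ A then 1 else 0) with hg
  have hg0 : ∀ y, 0 < g y := fun y => Real.exp_pos _
  have hwt : ∀ y : κ → Fin 2, 0 ≤ ∏ s, berWeight z (y s) := fun y =>
    Finset.prod_nonneg fun s _ => berWeight_nonneg hz0 hz1 _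
  -- Jensen's inequality under the uniform law on `M`, for `l` times the number of blocks whose
  -- pattern lies in `A`; the mean of this number is `J * u`.
  have h1 : Real.exp (J * l * u) ≤ ∑ ω ∈ M, (1 / (M.card : ℝ)) *
      ∏ t, g (fun s => X ω (Φ (t, s))) := by
    have hj := convexOn_exp.map_sum_le (t := M) (w := fun _ => 1 / (M.card : ℝ))
      (p := fun ω => ∑ t, l * if (fun s => X ω (Φ (t, s))) ∈ A then (1 : ℝ) else 0)
      (fun _ _ => by positivity) (by simp [hMc.ne']) (fun _ _ => Set.mem_univ _)
    simp only [smul_eq_mul] at hj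
    refine le_trans (le_of_eq ?_) (hj.trans (le_of_eq ?_))
    swap
    · simp only [hg, Real.exp_sum]
    congr 1
    rw [← Finset.mul_sum, Finset.sum_comm]
    have : ∀ t, ∑ ω ∈ M, l * (if (fun s => X ω (Φ (t, s))) ∈ A then (1 : ℝ) else 0)
        = l * (M.card * u) := by
      intro t
      rw [← Finset.mul_sum, ← hu t, Finset.sum_boole]
    rw [Finset.sum_congr rfl fun t _ => this t]
    simp only [Finset.sum_const, Finset.card_univ, nsmul_eq_mul]
    field_simp
    simp only [J]
    ring
  -- Change of measure: on `M` the product law has constant weight `c₀`. Enlarging the sum to all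
  -- matrices makes it factor over the blocks.
  have h2 : c₀ * ∑ ω ∈ M, ∏ t, g (fun s => X ω (Φ (t, s)))
      ≤ (∑ y : κ → Fin 2, (∏ s, berWeight z (y s)) * g y) ^ J := by
    rw [← sum_prod_berWeight_mul_prod w Φ hz g, Finset.mul_sum]
    calc ∑ ω ∈ M, c₀ * ∏ t, g (fun s => X ω (Φ (t, s)))
        = ∑ ω ∈ M, (∏ e, berWeight (w e) (X ω e)) * ∏ t, g (fun s => X ω (Φ (t, s))) :=
          Finset.sum_congr rfl fun ω hω => by rw [hc ω hω]
      _ = ∑ x ∈ M.image X, (∏ e, berWeight (w e) (x e)) * ∏ t, g (fun s => x (Φ (t, s))) := by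
          rw [Finset.sum_image fun _ _ _ _ h => hX h]
      _ ≤ _ := by
          refine Finset.sum_le_sum_of_subset_of_nonneg (Finset.subset_univ _) fun x _ _ => ?_
          exact mul_nonneg (Finset.prod_nonneg fun e _ => berWeight_nonneg (hw0 e) (hw1 e) _)
            (Finset.prod_nonneg fun t _ => (hg0 _).le)
  -- The exponential moment of one indicator of probability `Q`, by `exp l ≤ 1 + l + l ^ 2` for `0 ≤
  -- l ≤ 1`.
  have h3 : ∑ y : κ → Fin 2, (∏ s, berWeight z (y s)) * g y ≤ Real.exp (l * Q + l ^ 2) := by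
    have hexp : Real.exp l ≤ 1 + l + l ^ 2 := by
      have := Real.abs_exp_sub_one_sub_id_le (x := l) (by rw [abs_of_nonneg hl0]; exact hl1)
      have := (abs_le.1 this).2
      linarith
    have hQ1 : Q ≤ 1 := by
      rw [← sum_prod_berWeight κ fun _ => z]
      exact Finset.sum_le_sum_of_subset_of_nonneg (Finset.subset_univ _) fun y _ _ => hwt y
    have hgle : ∀ y, g y ≤ 1 + (l + l ^ 2) * if y ∈ A then 1 else 0 := by
      intro y
      simp only [hg]
      split_ifs
      · rw [mul_one, mul_one]; linarith
      · simp
    calc ∑ y : κ → Fin 2, (∏ s, berWeight z (y s)) * g y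
        ≤ ∑ y : κ → Fin 2, (∏ s, berWeight z (y s)) *
            (1 + (l + l ^ 2) * if y ∈ A then 1 else 0) :=
          Finset.sum_le_sum fun y _ => mul_le_mul_of_nonneg_left (hgle y) (hwt y)
      _ = 1 + (l + l ^ 2) * Q := by
          simp_rw [mul_add, mul_one, Finset.sum_add_distrib]
          rw [sum_prod_berWeight κ fun _ => z, hQ, Finset.mul_sum]
          congr 1
          rw [← Finset.sum_filter_add_sum_filter_not Finset.univ (· ∈ A),
            Finset.sum_eq_zero (s := Finset.univ.filter fun y => y ∉ A), add_zero,
            Finset.filter_mem_eq_inter, Finset.univ_inter]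
          · exact Finset.sum_congr rfl fun y hy => by simp [hy, mul_comm]
          · intro y hy
            simp only [Finset.mem_filter] at hy
            simp [hy.2]
      _ ≤ 1 + (l * Q + l ^ 2) := by nlinarith [sq_nonneg l]
      _ ≤ _ := by rw [add_comm]; exact Real.add_one_le_exp _
  have h4 : (∑ y : κ → Fin 2, (∏ s, berWeight z (y s)) * g y) ^ J
      ≤ Real.exp (J * (l * Q + l ^ 2)) := by
    rw [Real.exp_nat_mul]
    exact pow_le_pow_left₀ (Finset.sum_nonneg fun y _ => mul_nonneg (hwt y) (hg0 y).le) h3 _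
  have h5 : Real.exp (-L + J * l * u) ≤ Real.exp (J * (l * Q + l ^ 2)) := by
    calc Real.exp (-L + J * l * u) = Real.exp (-L) * Real.exp (J * l * u) := Real.exp_add _ _
      _ ≤ (M.card * c₀) * ∑ ω ∈ M, (1 / (M.card : ℝ)) * ∏ t, g (fun s => X ω (Φ (t, s))) := by
          gcongr
      _ = c₀ * ∑ ω ∈ M, ∏ t, g (fun s => X ω (Φ (t, s))) := by
          rw [← Finset.mul_sum]; field_simp
      _ ≤ _ := h2.trans h4
  have h6 := Real.exp_le_exp.1 h5
  linarith

/-- Under the assumptions of `mul_sub_le_of_blocks`, the law of a block is close in total variation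
to the product law. -/
theorem sum_abs_sub_le_of_blocks {Ω E ι κ : Type*} [Fintype Ω] [Fintype E] [DecidableEq E]
    [Fintype ι] [DecidableEq ι] [Fintype κ] [DecidableEq κ] (X : Ω → E → Fin 2)
    (hX : Function.Injective X) (M : Finset Ω) (hM : M.Nonempty) (w : E → ℝ)
    (hw0 : ∀ e, 0 ≤ w e) (hw1 : ∀ e, w e ≤ 1) {c₀ L : ℝ} (hc₀ : 0 < c₀)
    (hc : ∀ ω ∈ M, ∏ e, berWeight (w e) (X ω e) = c₀) (hL : Real.exp (-L) ≤ M.card * c₀)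
    (Φ : ι × κ ↪ E) {z : ℝ} (hz : ∀ x, w (Φ x) = z) (hz0 : 0 ≤ z) (hz1 : z ≤ 1)
    (U : (κ → Fin 2) → ℝ)
    (hU : ∀ t x, ((M.filter fun ω => (fun s => X ω (Φ (t, s))) = x).card : ℝ) = M.card * U x)
    (hU1 : ∑ x, U x = 1) (hL0 : 0 < L) (hLJ : L ≤ Fintype.card ι) :
    ∑ x, |U x - ∏ s, berWeight z (x s)| ≤ 4 * √(L / Fintype.card ι) := by
  classical
  set Q : (κ → Fin 2) → ℝ := fun x => ∏ s, berWeight z (x s) with hQ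
  -- On this set `U - Q` is nonnegative, so the distance is `2 * (U(A) - Q(A))`.
  set A : Finset (κ → Fin 2) := Finset.univ.filter fun x => Q x ≤ U x with hA
  have hJ : (0 : ℝ) < Fintype.card ι := hL0.trans_le hLJ
  -- This choice balances the two error terms: `J * l ^ 2 = L`.
  set l := √(L / Fintype.card ι) with hl
  have hl0 : 0 < l := Real.sqrt_pos.2 (by positivity)
  have hl1 : l ≤ 1 := Real.sqrt_le_one.2 (div_le_one_of_le₀ hLJ hJ.le)
  have hl2 : Fintype.card ι * l ^ 2 = L := by
    rw [hl, Real.sq_sqrt (by positivity)]; field_simp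
  have h := mul_sub_le_of_blocks X hX M hM w hw0 hw1 hc₀ hc hL Φ hz hz0 hz1 A
    (u := ∑ x ∈ A, U x) (fun t => by
      rw [Finset.mul_sum, ← Finset.sum_congr rfl fun x _ => hU t x, ← Nat.cast_sum]
      congr 1
      rw [Finset.card_eq_sum_card_fiberwise (f := fun ω => fun s => X ω (Φ (t, s))) (t := A)]
      · refine Finset.sum_congr rfl fun x hx => ?_
        rw [Finset.filter_filter]
        congr 1
        ext ω
        simp only [Finset.mem_filter]
        constructor
        · rintro ⟨h1, -, h2⟩; exact ⟨h1, h2⟩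
        · rintro ⟨h1, h2⟩; exact ⟨h1, by rw [h2]; exact hx, h2⟩
      · intro ω hω
        simp only [Finset.coe_filter, Set.mem_ofPred_eq] at hω
        exact hω.2) hl0.le hl1
  have h1 : ∑ x ∈ A, U x - ∑ x ∈ A, Q x ≤ 2 * l := by
    rw [hl2] at h
    have : Fintype.card ι * l * (∑ x ∈ A, U x - ∑ x ∈ A, Q x) ≤ Fintype.card ι * l * (2 * l) := by
      calc _ = _ := mul_assoc _ _ _
        _ ≤ L + L := h
        _ = _ := by rw [← hl2]; ring
    exact le_of_mul_le_mul_left this (by positivity)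
  have h2 : ∑ x, |U x - Q x| = 2 * (∑ x ∈ A, U x - ∑ x ∈ A, Q x) - ∑ x, (U x - Q x) := by
    rw [← Finset.sum_sub_distrib, hA, Finset.sum_filter, Finset.mul_sum, ← Finset.sum_sub_distrib]
    refine Finset.sum_congr rfl fun x _ => ?_
    split_ifs with hx
    · rw [abs_of_nonneg (by linarith)]; ring
    · rw [abs_of_neg (by linarith)]; ring
  rw [h2, Finset.sum_sub_distrib, hU1, hQ, sum_prod_berWeight κ fun _ => z]
  linarith

/-! ### Exchangeability of rows and columns with equal margins. -/

/-- A permutation that moves one family of columns to another and preserves the margins. -/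
theorem exists_perm_of_injective {N k : ℕ} (c : Fin N → ℕ) {v : ℕ} {f g : Fin k → Fin N}
    (hf : Function.Injective f) (hg : Function.Injective g) (hfc : ∀ s, c (f s) = v)
    (hgc : ∀ s, c (g s) = v) : ∃ τ : Equiv.Perm (Fin N), (∀ s, τ (f s) = g s) ∧ ∀ j, c (τ j) = c j := by
  classical
  let f' : Fin k → {j : Fin N // c j = v} := fun s => ⟨f s, hfc s⟩
  let g' : Fin k → {j : Fin N // c j = v} := fun s => ⟨g s, hgc s⟩
  have hf' : Function.Injective f' := fun s t h => hf (Subtype.ext_iff.1 h)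
  have hg' : Function.Injective g' := fun s t h => hg (Subtype.ext_iff.1 h)
  let e : {x : {j : Fin N // c j = v} // x ∈ Set.range f'} ≃ {x : {j : Fin N // c j = v} // x ∈ Set.range g'} :=
    (Equiv.ofInjective f' hf').symm.trans (Equiv.ofInjective g' hg')
  refine ⟨Equiv.Perm.ofSubtype (p := fun j => c j = v) e.extendSubtype, fun s => ?_, fun j => ?_⟩
  · rw [Equiv.Perm.ofSubtype_apply_of_mem (p := fun j => c j = v) _ (hfc s)]
    have h := e.extendSubtype_apply_of_mem (f' s) ⟨s, rfl⟩
    have h2 : e ⟨f' s, ⟨s, rfl⟩⟩ = ⟨g' s, ⟨s, rfl⟩⟩ := by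
      have : (Equiv.ofInjective f' hf').symm ⟨f' s, ⟨s, rfl⟩⟩ = s :=
        Equiv.ofInjective_symm_apply hf' s
      simp only [e, Equiv.trans_apply, this]
      rfl
    rw [h2] at h
    exact congrArg Subtype.val h
  · by_cases hj : c j = v
    · rw [Equiv.Perm.ofSubtype_apply_of_mem (p := fun j => c j = v) _ hj, hj]
      exact (e.extendSubtype ⟨j, hj⟩).2
    · rw [Equiv.Perm.ofSubtype_apply_of_not_mem (p := fun j => c j = v) _ hj]

/-- Entries in rows of equal margin and columns of equal margin are exchangeable. -/
theorem card_filter_tabs_eq {N k : ℕ} (r c : Fin N → ℕ) {v : ℕ} {i i' : Fin N}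
    (hi : r i = r i') {f g : Fin k → Fin N} (hf : Function.Injective f)
    (hg : Function.Injective g) (hfc : ∀ s, c (f s) = v) (hgc : ∀ s, c (g s) = v)
    (x : Fin k → Fin 2) :
    ((tabs r c).filter fun d => (fun s => d i (f s)) = x).card
      = ((tabs r c).filter fun d => (fun s => d i' (g s)) = x).card := by
  obtain ⟨τ, hτ, hτc⟩ := exists_perm_of_injective c hf hg hfc hgc
  have hσ : ∀ y, r (Equiv.swap i i' y) = r y := by
    intro y
    rw [Equiv.swap_apply_def]
    split_ifs with h1 h2
    · rw [h1, hi]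
    · rw [h2, hi]
    · rfl
  have hmem : ∀ (σ τ : Equiv.Perm (Fin N)), (∀ y, r (σ y) = r y) → (∀ y, c (τ y) = c y) →
      ∀ d ∈ tabs r c, (fun y j => d (σ y) (τ j)) ∈ tabs r c := by
    intro σ τ hs ht d hd
    rw [mem_tabs] at hd ⊢
    refine ⟨fun y => ?_, fun j => ?_⟩
    · rw [← hs y, ← hd.1 (σ y)]
      exact Equiv.sum_comp τ fun j => (d (σ y) j : ℕ)
    · rw [← ht j, ← hd.2 (τ j)]
      exact Equiv.sum_comp σ fun y => (d y (τ j) : ℕ)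
  have hτc' : ∀ y, c (τ.symm y) = c y := fun y => by rw [← hτc, Equiv.apply_symm_apply]
  have hτ' : ∀ s, τ.symm (g s) = f s := fun s => by rw [← hτ, Equiv.symm_apply_apply]
  refine Finset.card_bij' (fun d _ => fun y j => d (Equiv.swap i i' y) (τ.symm j))
    (fun d _ => fun y j => d (Equiv.swap i i' y) (τ j)) ?_ ?_ ?_ ?_
  · intro d hd
    rw [Finset.mem_filter] at hd ⊢
    exact ⟨hmem _ _ hσ hτc' _ hd.1, by simpa [hτ'] using hd.2⟩
  · intro d hd
    rw [Finset.mem_filter] at hd ⊢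
    exact ⟨hmem _ _ hσ hτc _ hd.1, by simpa [hτ] using hd.2⟩
  · intro d _; simp
  · intro d _; simp

/-! ### The laws as finite counts. -/

theorem ber_real_singleton {z : ℝ} (hz : 0 ≤ z) (hz1 : z ≤ 1) (x : Fin 2) :
    (ber z).real {x} = berWeight z x := by
  have hp : ((Set.projIcc (0 : ℝ) 1 zero_le_one z : Set.Icc (0 : ℝ) 1) : ℝ) = z := by
    rw [Set.projIcc_of_mem _ ⟨hz, hz1⟩]
  rw [ber, bernoulliMeasure_real_apply _ (measurableSet_singleton x)]
  generalize Set.projIcc (0 : ℝ) 1 zero_le_one z = p at hp ⊢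
  subst hp
  fin_cases x <;> simp [berWeight]

instance (z : ℝ) : IsProbabilityMeasure (ber z) := by
  rw [ber]; infer_instance

theorem iidBer_real_singleton {z : ℝ} (hz : 0 ≤ z) (hz1 : z ≤ 1) {k : ℕ} (x : Fin k → Fin 2) :
    (iidBer k z).real {x} = ∏ s, berWeight z (x s) := by
  rw [iidBer, measureReal_def, Measure.pi_singleton, ENNReal.toReal_prod]
  exact Finset.prod_congr rfl fun s _ => ber_real_singleton hz hz1 (x s)

theorem rowLaw_real_singleton (n : ℕ) (δ B C : ℝ) (i j k : ℕ) (x : Fin k → Fin 2) :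
    (rowLaw n δ B C i j k).real {x}
      = (((tabs (margin n δ B C) (margin n δ B C)).filter fun d =>
          (fun t : Fin k => entry d i (j + (t + 1))) = x).card : ℝ) /
        (tabs (margin n δ B C) (margin n δ B C)).card := by
  classical
  rw [rowLaw, map_measureReal_apply (measurable_of_finite _) (measurableSet_singleton x),
    tableSet, ← coe_tabs, measureReal_def]
  have : (fun X : Fin (topSize n δ + n) → Fin (topSize n δ + n) → Fin 2 =>
      fun t : Fin k => entry X i (j + (t + 1))) ⁻¹' {x}
      = ((Finset.univ.filter fun d => (fun t : Fin k => entry d i (j + (t + 1))) = x :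
        Finset (Fin (topSize n δ + n) → Fin (topSize n δ + n) → Fin 2)) :
        Set (Fin (topSize n δ + n) → Fin (topSize n δ + n) → Fin 2)) := by
    ext d; simp
  rw [this, uniformOn_apply_finset, ENNReal.toReal_div, ENNReal.toReal_natCast,
    ENNReal.toReal_natCast]
  congr 3
  ext d; simp

theorem dTV_rowLaw_iidBer (n : ℕ) (δ B C : ℝ) (i j k : ℕ) {z : ℝ} (hz : 0 ≤ z) (hz1 : z ≤ 1) :
    dTV (rowLaw n δ B C i j k) (iidBer k z) = ∑ x : Fin k → Fin 2,
      |(((tabs (margin n δ B C) (margin n δ B C)).filter fun d =>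
          (fun t : Fin k => entry d i (j + (t + 1))) = x).card : ℝ) /
        (tabs (margin n δ B C) (margin n δ B C)).card - ∏ s, berWeight z (x s)| := by
  rw [dTV]
  exact Finset.sum_congr rfl fun x _ => by
    rw [rowLaw_real_singleton, iidBer_real_singleton hz hz1]

/-! ### Initial segments of exchangeable binary sequences. -/

/-- The case split is needed: if the prefix already exceeds `s`, truncated subtraction would give
`l.choose 0 = 1` instead of `0`. -/
theorem card_filter_extensions {k l s : ℕ} (x : Fin k → Fin 2) :
    (Finset.univ.filter fun y : Fin (k + l) → Fin 2 =>
      ∑ j, (y j : ℕ) = s ∧ (fun t => y (Fin.castAdd l t)) = x).card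
      = if ∑ t, (x t : ℕ) ≤ s then l.choose (s - ∑ t, (x t : ℕ)) else 0 := by
  split_ifs with h
  · rw [← card_filter_sum_eq]
    refine Finset.card_bij' (fun y _ => fun t => y (Fin.natAdd k t)) (fun v _ => Fin.append x v)
      ?_ ?_ ?_ ?_
    · intro y hy
      simp only [Finset.mem_filter, Finset.mem_univ, true_and, Fin.sum_univ_add] at hy ⊢
      have e : ∑ t, (x t : ℕ) = ∑ t, (y (Fin.castAdd l t) : ℕ) := by rw [← hy.2]
      omega
    · intro v hv
      simp only [Finset.mem_filter, Finset.mem_univ, true_and, Fin.sum_univ_add, Fin.append_left,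
        Fin.append_right] at hv ⊢
      exact ⟨by omega, trivial⟩
    · intro y hy
      simp only [Finset.mem_filter, Finset.mem_univ, true_and] at hy
      funext j
      refine Fin.addCases (fun j => ?_) (fun j => ?_) j
      · simp [← hy.2]
      · simp
    · intro v _
      funext j; simp
  · rw [Finset.card_eq_zero, Finset.filter_eq_empty_iff]
    rintro y - ⟨h1, h2⟩
    rw [Fin.sum_univ_add] at h1
    have e : ∑ t, (x t : ℕ) = ∑ t, (y (Fin.castAdd l t) : ℕ) := by rw [← h2]
    omega

theorem sum_val_le {k : ℕ} (x : Fin k → Fin 2) : ∑ t, (x t : ℕ) ≤ k := by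
  calc ∑ t, (x t : ℕ) ≤ ∑ _t : Fin k, 1 := Finset.sum_le_sum fun s _ => by omega
    _ = k := by simp

/-- The initial segment of an exchangeable binary sequence with known sum is close to an
independent sequence. -/
theorem sum_abs_sub_le_of_exchangeable_of_sum {Ω : Type*} {k l s : ℕ}
    (M : Finset Ω) (hM : M.Nonempty) (Y : Ω → Fin (k + l) → Fin 2)
    (hY : ∀ y y' : Fin (k + l) → Fin 2, ∑ j, (y j : ℕ) = ∑ j, (y' j : ℕ) →
      (M.filter fun ω => Y ω = y).card = (M.filter fun ω => Y ω = y').card)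
    (hs : ∀ ω ∈ M, ∑ j, (Y ω j : ℕ) = s) :
    ∑ x : Fin k → Fin 2, |((M.filter fun ω => (fun t => Y ω (Fin.castAdd l t)) = x).card : ℝ) /
      M.card - ∏ t, berWeight (s / (k + l : ℕ)) (x t)| ≤ 2 * (k / (l + 1)) := by
  classical
  obtain ⟨ω₀, hω₀⟩ := hM
  have hMc : (0 : ℝ) < M.card := by exact_mod_cast Finset.card_pos.2 ⟨ω₀, hω₀⟩
  -- By exchangeability every pattern of sum `s` has this same number of preimages, so `f` cancels
  -- in the ratio.
  set f := (M.filter fun ω => Y ω = Y ω₀).card with hf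
  have hsn : s ≤ k + l := by rw [← hs ω₀ hω₀]; exact sum_val_le _
  have hcount : ∀ x : Fin k → Fin 2,
      (M.filter fun ω => (fun t => Y ω (Fin.castAdd l t)) = x).card
        = (if ∑ t, (x t : ℕ) ≤ s then l.choose (s - ∑ t, (x t : ℕ)) else 0) * f := by
    intro x
    rw [← card_filter_extensions x, Finset.card_eq_sum_card_fiberwise (f := Y)
      (t := Finset.univ.filter fun y : Fin (k + l) → Fin 2 =>
        ∑ j, (y j : ℕ) = s ∧ (fun t => y (Fin.castAdd l t)) = x)]
    · rw [← smul_eq_mul, ← Finset.sum_const]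
      refine Finset.sum_congr rfl fun y hy => ?_
      simp only [Finset.mem_filter, Finset.mem_univ, true_and] at hy
      rw [hf, ← hY y (Y ω₀) (by rw [hy.1, hs ω₀ hω₀]), Finset.filter_filter]
      congr 1
      ext ω
      simp only [Finset.mem_filter]
      constructor
      · rintro ⟨h1, -, h2⟩; exact ⟨h1, h2⟩
      · rintro ⟨h1, h2⟩; exact ⟨h1, by rw [h2]; exact hy.2, h2⟩
    · intro ω hω
      simp only [Finset.coe_filter, Set.mem_ofPred_eq, Finset.mem_univ, true_and] at hω ⊢
      exact ⟨hs ω hω.1, hω.2⟩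
  have hcard : M.card = (k + l).choose s * f := by
    rw [← card_filter_sum_eq, Finset.card_eq_sum_card_fiberwise (f := Y)
      (t := Finset.univ.filter fun y : Fin (k + l) → Fin 2 => ∑ j, (y j : ℕ) = s)]
    · rw [← smul_eq_mul, ← Finset.sum_const]
      refine Finset.sum_congr rfl fun y hy => ?_
      simp only [Finset.mem_filter, Finset.mem_univ, true_and] at hy
      exact hY y (Y ω₀) (by rw [hy, hs ω₀ hω₀])
    · intro ω hω
      simp only [Finset.coe_filter, Set.mem_ofPred_eq, Finset.mem_univ, true_and]
      exact hs ω hω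
  have hp0 : (0 : ℝ) ≤ s / (k + l : ℕ) := by positivity
  have hp1 : (s : ℝ) / (k + l : ℕ) ≤ 1 :=
    div_le_one_of_le₀ (by exact_mod_cast hsn) (by positivity)
  refine sum_abs_sub_le_of_le_mul
    (fun x => Finset.prod_nonneg fun t _ => berWeight_nonneg hp0 hp1 _) ?_
    (sum_prod_berWeight _ _) (by positivity) fun x => ?_
  · rw [← Finset.sum_div, div_eq_one_iff_eq hMc.ne', ← Nat.cast_sum]
    congr 1
    exact (Finset.card_eq_sum_card_fiberwise fun _ _ => Finset.mem_coe.2 (Finset.mem_univ _)).symm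
  · rw [div_le_iff₀ hMc, hcount, hcard, prod_berWeight]
    by_cases ht : ∑ t, (x t : ℕ) ≤ s
    · have h := choose_mul_le_of_sampling hsn (Nat.le_add_right k l) ht (sum_val_le x)
      rw [if_pos ht]
      rw [Nat.add_sub_cancel_left] at h
      have hl : (0 : ℝ) < l + 1 := by positivity
      have e1 : ((k + l : ℕ) : ℝ) - k + 1 = l + 1 := by push_cast; ring
      rw [e1, ← le_div_iff₀ hl] at h
      rw [Nat.cast_mul, Nat.cast_mul]
      calc (l.choose (s - ∑ t, (x t : ℕ)) : ℝ) * f ≤ _ * f :=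
            mul_le_mul_of_nonneg_right h (by positivity)
        _ = _ := by
            -- The factor `(n + 1) / (n - k + 1)` for sampling without replacement, with `n = k +
            -- l`.
            have e2 : (1 : ℝ) + k / (l + 1) = ((k + l : ℕ) + 1) / (l + 1) := by
              push_cast; field_simp; ring
            rw [e2]; ring
    · rw [if_neg ht]
      have : (0 : ℝ) ≤ 1 - s / (k + l : ℕ) := by linarith
      simp only [zero_mul, Nat.cast_zero]
      positivity

/-- The initial segment of an exchangeable binary sequence with almost constant mean is close to
an independent sequence. -/
theorem sum_abs_sub_le_of_exchangeable {Ω : Type*} {k l : ℕ}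
    (M : Finset Ω) (hM : M.Nonempty) (Y : Ω → Fin (k + l) → Fin 2)
    (hY : ∀ y y' : Fin (k + l) → Fin 2, ∑ j, (y j : ℕ) = ∑ j, (y' j : ℕ) →
      (M.filter fun ω => Y ω = y).card = (M.filter fun ω => Y ω = y').card)
    {z η : ℝ} (hz0 : 0 ≤ z) (hz1 : z ≤ 1)
    (hη : ∀ ω ∈ M, |((∑ j, (Y ω j : ℕ) : ℕ) : ℝ) / (k + l : ℕ) - z| ≤ η) :
    ∑ x : Fin k → Fin 2, |((M.filter fun ω => (fun t => Y ω (Fin.castAdd l t)) = x).card : ℝ) /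
      M.card - ∏ t, berWeight z (x t)| ≤ 2 * (k / (l + 1)) + 2 * k * η := by
  classical
  have hMc : (0 : ℝ) < M.card := by exact_mod_cast hM.card_pos
  set K : ℝ := 2 * (k / (l + 1)) + 2 * k * η with hK
  set S := M.image fun ω => ∑ j, (Y ω j : ℕ) with hS
  set Ms : ℕ → Finset Ω := fun s => M.filter fun ω => ∑ j, (Y ω j : ℕ) = s with hMs
  have hsplit : ∀ M' : Finset Ω, M' ⊆ M → (M'.card : ℝ)
      = ∑ s ∈ S, ((M'.filter fun ω => ∑ j, (Y ω j : ℕ) = s).card : ℝ) := by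
    intro M' hM'
    rw [← Nat.cast_sum]
    congr 1
    exact Finset.card_eq_sum_card_fiberwise fun ω hω =>
      Finset.mem_coe.2 (Finset.mem_image_of_mem _ (hM' hω))
  -- Conditionally on the sum `s`, the segment is close to Bernoulli with mean `s / (k + l)`, and
  -- that mean is within `η` of `z`. Averaging over `s` keeps the bound.
  have hpart : ∀ s ∈ S, ∑ x : Fin k → Fin 2,
      |(((Ms s).filter fun ω => (fun t => Y ω (Fin.castAdd l t)) = x).card : ℝ)
        - (Ms s).card * ∏ t, berWeight z (x t)| ≤ (Ms s).card * K := by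
    intro s hs
    rw [hS, Finset.mem_image] at hs
    obtain ⟨ω₀, hω₀, hsum⟩ := hs
    have hne : (Ms s).Nonempty := ⟨ω₀, Finset.mem_filter.2 ⟨hω₀, hsum⟩⟩
    have hc : (0 : ℝ) < (Ms s).card := by exact_mod_cast hne.card_pos
    have hsn : s ≤ k + l := by rw [← hsum]; exact sum_val_le _
    have hp0 : (0 : ℝ) ≤ s / (k + l : ℕ) := by positivity
    have hp1 : (s : ℝ) / (k + l : ℕ) ≤ 1 :=
      div_le_one_of_le₀ (by exact_mod_cast hsn) (by positivity)
    have h1 := sum_abs_sub_le_of_exchangeable_of_sum (Ms s) hne Y (fun y y' hyy => by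
      by_cases hy : ∑ j, (y j : ℕ) = s
      · have := hY y y' hyy
        have e : ∀ y : Fin (k + l) → Fin 2, ∑ j, (y j : ℕ) = s →
            ((Ms s).filter fun ω => Y ω = y) = M.filter fun ω => Y ω = y := by
          intro y hy
          ext ω
          simp only [hMs, Finset.mem_filter]
          constructor
          · rintro ⟨⟨h1, -⟩, h2⟩; exact ⟨h1, h2⟩
          · rintro ⟨h1, h2⟩; exact ⟨⟨h1, by rw [h2]; exact hy⟩, h2⟩
        rw [e y hy, e y' (by rw [← hyy, hy]), this]
      · have e : ∀ y : Fin (k + l) → Fin 2, ∑ j, (y j : ℕ) ≠ s →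
            ((Ms s).filter fun ω => Y ω = y) = ∅ := by
          intro y hy
          rw [Finset.filter_eq_empty_iff]
          intro ω hω h
          simp only [hMs, Finset.mem_filter] at hω
          rw [h] at hω
          exact hy hω.2
        rw [e y hy, e y' (by rw [← hyy]; exact hy)])
      (s := s) (fun ω hω => (Finset.mem_filter.1 hω).2)
    have h2 := sum_abs_prod_berWeight_sub_le hp0 hp1 hz0 hz1 k
    have h3 := hη ω₀ hω₀
    rw [hsum] at h3
    calc ∑ x : Fin k → Fin 2,
        |(((Ms s).filter fun ω => (fun t => Y ω (Fin.castAdd l t)) = x).card : ℝ)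
          - (Ms s).card * ∏ t, berWeight z (x t)|
        ≤ ∑ x : Fin k → Fin 2, (Ms s).card *
          (|(((Ms s).filter fun ω => (fun t => Y ω (Fin.castAdd l t)) = x).card : ℝ) / (Ms s).card
            - ∏ t, berWeight (s / (k + l : ℕ)) (x t)|
          + |∏ t, berWeight (s / (k + l : ℕ)) (x t) - ∏ t, berWeight z (x t)|) := by
          refine Finset.sum_le_sum fun x _ => ?_
          have := abs_sub_le
            ((((Ms s).filter fun ω => (fun t => Y ω (Fin.castAdd l t)) = x).card : ℝ) / (Ms s).card)
            (∏ t, berWeight (s / (k + l : ℕ)) (x t)) (∏ t, berWeight z (x t))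
          refine le_trans (le_of_eq ?_) (mul_le_mul_of_nonneg_left this hc.le)
          rw [← abs_of_pos hc, ← abs_mul, abs_of_pos hc]
          congr 1
          field_simp
      _ ≤ (Ms s).card * (2 * (k / (l + 1)) + 2 * k * |(s : ℝ) / (k + l : ℕ) - z|) := by
          rw [← Finset.mul_sum, Finset.sum_add_distrib]
          gcongr
      _ ≤ (Ms s).card * K := by
          rw [hK]; gcongr
  have hfin : ∑ x : Fin k → Fin 2,
      |((M.filter fun ω => (fun t => Y ω (Fin.castAdd l t)) = x).card : ℝ)
        - M.card * ∏ t, berWeight z (x t)| ≤ M.card * K := by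
    calc _ ≤ ∑ x : Fin k → Fin 2, ∑ s ∈ S,
          |(((Ms s).filter fun ω => (fun t => Y ω (Fin.castAdd l t)) = x).card : ℝ)
          - (Ms s).card * ∏ t, berWeight z (x t)| := by
          refine Finset.sum_le_sum fun x _ => ?_
          rw [hsplit _ (Finset.filter_subset _ _), hsplit M subset_rfl, Finset.sum_mul,
            ← Finset.sum_sub_distrib]
          refine (Finset.abs_sum_le_sum_abs _ _).trans (le_of_eq ?_)
          refine Finset.sum_congr rfl fun s _ => ?_
          rw [Finset.filter_comm]
      _ = ∑ s ∈ S, ∑ x : Fin k → Fin 2,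
          |(((Ms s).filter fun ω => (fun t => Y ω (Fin.castAdd l t)) = x).card : ℝ)
          - (Ms s).card * ∏ t, berWeight z (x t)| := Finset.sum_comm
      _ ≤ ∑ s ∈ S, (Ms s).card * K := Finset.sum_le_sum hpart
      _ = M.card * K := by rw [← Finset.sum_mul, ← hsplit M subset_rfl]
  refine le_of_mul_le_mul_left ?_ hMc
  refine le_trans (le_of_eq ?_) hfin
  rw [Finset.mul_sum]
  refine Finset.sum_congr rfl fun x _ => ?_
  rw [← abs_of_pos hMc, ← abs_mul, abs_of_pos hMc]
  congr 1
  field_simp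

theorem exists_perm_of_sum_eq {n : ℕ} {y y' : Fin n → Fin 2}
    (h : ∑ j, (y j : ℕ) = ∑ j, (y' j : ℕ)) : ∃ π : Equiv.Perm (Fin n), y' ∘ π = y := by
  classical
  have hs : ∀ x : Fin n → Fin 2, ∑ j, (x j : ℕ) = Fintype.card {j // x j = 1} := by
    intro x
    rw [Fintype.card_subtype, Finset.card_filter]
    refine Finset.sum_congr rfl fun j _ => ?_
    generalize x j = y
    revert y; decide
  rw [hs, hs] at h
  let e : {j // y j = 1} ≃ {j // y' j = 1} := Fintype.equivOfCardEq h
  refine ⟨e.extendSubtype, funext fun j => ?_⟩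
  by_cases hj : y j = 1
  · rw [hj]; exact e.extendSubtype_mem j hj
  · have h1 := e.extendSubtype_not_mem j hj
    simp only [Function.comp]
    generalize y' (e.extendSubtype j) = u at h1 ⊢
    generalize y j = v at hj ⊢
    revert u v; decide

/-- Patterns of equal sum differ by a permutation of the chosen columns, which all have the same
margin. -/
theorem card_filter_row_eq_of_sum_eq {N n : ℕ} (r c : Fin N → ℕ) {v : ℕ} (i : Fin N)
    {f : Fin n → Fin N} (hf : Function.Injective f) (hfc : ∀ s, c (f s) = v)
    {y y' : Fin n → Fin 2} (h : ∑ j, (y j : ℕ) = ∑ j, (y' j : ℕ)) :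
    ((tabs r c).filter fun d => (fun s => d i (f s)) = y).card
      = ((tabs r c).filter fun d => (fun s => d i (f s)) = y').card := by
  obtain ⟨π, hπ⟩ := exists_perm_of_sum_eq h
  rw [card_filter_tabs_eq r c rfl hf (hf.comp π.injective) hfc (fun s => hfc (π s)) y]
  congr 1
  ext d
  simp only [Finset.mem_filter, and_congr_right_iff, ← hπ]
  intro _
  constructor
  · intro hd
    funext s
    have := congrFun hd (π.symm s)
    simpa using this
  · rintro rfl
    rfl

/-! ### Tables with two-step margins and the block-constant Bernoulli matrix. -/

/-- The balanced vector of length `n` with sum `t`. -/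
def balanced (n t : ℕ) : Fin n → ℕ := fun j => t / n + if (j : ℕ) < t % n then 1 else 0

theorem sum_balanced {n : ℕ} (hn : 0 < n) (t : ℕ) : ∑ j, balanced n t j = t := by
  simp only [balanced, Finset.sum_add_distrib, Finset.sum_const, Finset.card_univ,
    Fintype.card_fin, smul_eq_mul]
  rw [Fin.sum_univ_eq_sum_range (fun j => if j < t % n then 1 else 0) n, ← Finset.sum_filter]
  have : (Finset.range n).filter (fun j => j < t % n) = Finset.range (t % n) := by
    ext j
    have := Nat.mod_lt t hn
    simp only [Finset.mem_filter, Finset.mem_range]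
    omega
  rw [this]
  simpa using Nat.div_add_mod t n

theorem balanced_le_succ (n t : ℕ) (j l : Fin n) : balanced n t j ≤ balanced n t l + 1 := by
  simp only [balanced]; split_ifs <;> omega

theorem balanced_le (n t : ℕ) (j : Fin n) : balanced n t j ≤ t / n + 1 := by
  simp only [balanced]; split_ifs <;> omega

theorem le_balanced (n t : ℕ) (j : Fin n) : t / n ≤ balanced n t j := by
  simp only [balanced]; split_ifs <;> omega

/-- The vector with `m` entries `b` followed by `n` entries `c`. -/
def twoStep (m n b c : ℕ) : Fin (m + n) → ℕ := fun i => if (i : ℕ) < m then b else c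

theorem twoStep_castAdd {m n b c : ℕ} (i : Fin m) : twoStep m n b c (Fin.castAdd n i) = b := by
  simp [twoStep]

theorem twoStep_natAdd {m n b c : ℕ} (i : Fin n) : twoStep m n b c (Fin.natAdd m i) = c := by
  simp [twoStep]

theorem twoStep_eq_append {m n b c : ℕ} {f₁ f₂ : Fin m → ℕ} {g₁ g₂ : Fin n → ℕ}
    (hf : ∀ i, f₁ i + f₂ i = b) (hg : ∀ i, g₁ i + g₂ i = c) :
    Fin.append (f₁ + f₂) (g₁ + g₂) = twoStep m n b c := by
  funext i
  refine Fin.addCases (fun i => ?_) (fun i => ?_) i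
  · rw [Fin.append_left, twoStep_castAdd]; exact hf i
  · rw [Fin.append_right, twoStep_natAdd]; exact hg i

/-- The top left block gets constant margins `a`. The remaining `b - a` of each top row is spread
evenly over the `n` other columns, and the bottom right block takes what is left. The two side
blocks are transposes of each other, whence the repeated factor. -/
theorem card_tabs_twoStep {m n a b c : ℕ} (hab : a ≤ b)
    (hs : ∀ j, balanced n (m * (b - a)) j ≤ c) :
    (tabs (fun _ : Fin m => a) (fun _ : Fin m => a)).card *
      (tabs (fun _ : Fin m => b - a) (balanced n (m * (b - a)))).card *
      (tabs (fun _ : Fin m => b - a) (balanced n (m * (b - a)))).card *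
      (tabs (fun j => c - balanced n (m * (b - a)) j)
        (fun j => c - balanced n (m * (b - a)) j)).card
      ≤ (tabs (twoStep m n b c) (twoStep m n b c)).card := by
  have h := card_tabs_blocks (fun _ : Fin m => a) (fun _ : Fin m => b - a)
    (balanced n (m * (b - a))) (fun j => c - balanced n (m * (b - a)) j)
    (fun _ : Fin m => a) (fun _ : Fin m => b - a)
    (balanced n (m * (b - a))) (fun j => c - balanced n (m * (b - a)) j)
  rw [twoStep_eq_append (b := b) (c := c) (fun _ => by omega)
    (fun j => Nat.add_sub_cancel' (hs j)),
    card_tabs_transpose (balanced n (m * (b - a))) (fun _ : Fin m => b - a)] at h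
  exact h

/-- A zero top left block is enough: the column sums of the side block are then at most `m + 1 ≤ c`.
-/
theorem card_tabs_twoStep_pos {m n b c : ℕ} (hn : 0 < n) (hb : b ≤ n) (hc : c ≤ n)
    (hm : m < c) : 0 < (tabs (twoStep m n b c) (twoStep m n b c)).card := by
  have h1 : m * b / n ≤ m := by
    calc m * b / n ≤ m * n / n := Nat.div_le_div_right (Nat.mul_le_mul_left _ hb)
      _ = m := Nat.mul_div_cancel _ hn
  refine lt_of_lt_of_le ?_ (card_tabs_twoStep (a := 0) (Nat.zero_le b) fun j =>
    (balanced_le _ _ _).trans (by rw [Nat.sub_zero]; omega))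
  have h12 : 0 < (tabs (fun _ : Fin m => b - 0) (balanced n (m * (b - 0)))).card :=
    card_tabs_pos (fun _ => by omega) (balanced_le_succ _ _) (by rw [sum_balanced hn]; simp)
  have h11 : 0 < (tabs (fun _ : Fin m => 0) (fun _ : Fin m => 0)).card :=
    card_tabs_pos (fun _ => by omega) (fun _ _ => by omega) rfl
  have h22 : 0 < (tabs (fun j => c - balanced n (m * (b - 0)) j)
      (fun j => c - balanced n (m * (b - 0)) j)).card :=
    card_tabs_pos (fun _ => by omega) (fun j l => by
      have := balanced_le_succ n (m * (b - 0)) l j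
      omega) rfl
  positivity

/-- The matrix of means that is constant on each of the four blocks. -/
def blockMean (m n : ℕ) (z₁₁ z₁₂ z₂₂ : ℝ) (e : Fin (m + n) × Fin (m + n)) : ℝ :=
  if (e.1 : ℕ) < m then if (e.2 : ℕ) < m then z₁₁ else z₁₂
  else if (e.2 : ℕ) < m then z₁₂ else z₂₂

/-- With odds `u i * v j`, each unit in row `i` and column `j` contributes `u i * v j`, so the
weight sees only the margins. -/
theorem prod_berWeight_of_mem_tabs {p q : ℕ} {r : Fin p → ℕ} {c : Fin q → ℕ}
    (w : Fin p × Fin q → ℝ) (u : Fin p → ℝ) (v : Fin q → ℝ)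
    (hw : ∀ i j, w (i, j) = (1 - w (i, j)) * (u i * v j)) {d : Fin p → Fin q → Fin 2}
    (hd : d ∈ tabs r c) :
    ∏ e : Fin p × Fin q, berWeight (w e) (d e.1 e.2)
      = (∏ i, ∏ j, (1 - w (i, j))) * ((∏ i, u i ^ r i) * ∏ j, v j ^ c j) := by
  have h : ∀ i j, berWeight (w (i, j)) (d i j)
      = (1 - w (i, j)) * (u i ^ (d i j : ℕ) * v j ^ (d i j : ℕ)) := by
    intro i j
    have := hw i j
    generalize d i j = x
    fin_cases x
    · simp [berWeight]
    · simpa [berWeight] using this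
  rw [mem_tabs] at hd
  rw [Fintype.prod_prod_type]
  simp_rw [h, Finset.prod_mul_distrib, Finset.prod_pow_eq_pow_sum, hd.1]
  congr 2
  rw [Finset.prod_comm]
  simp_rw [Finset.prod_pow_eq_pow_sum, hd.2]

theorem pow_mul_pow_eq {z o : ℝ} (hz : z = (1 - z) * o) {s N : ℕ} (hs : s ≤ N) :
    z ^ s * (1 - z) ^ (N - s) = (1 - z) ^ N * o ^ s := by
  calc z ^ s * (1 - z) ^ (N - s) = ((1 - z) * o) ^ s * (1 - z) ^ (N - s) := by rw [← hz]
    _ = ((1 - z) ^ s * (1 - z) ^ (N - s)) * o ^ s := by rw [mul_pow]; ring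
    _ = _ := by rw [← pow_add, Nat.add_sub_cancel' hs]

/-- A random matrix with independent Bernoulli entries and block-constant means of product odds
gives all tables with two-step margins the same probability, and their total probability is
bounded from below. -/
theorem exp_le_card_tabs_twoStep {m n a b c : ℕ} (hn : 0 < n) (hmn : m ≤ n) (ham : a ≤ m)
    (hab : a ≤ b) (hbn : b - a ≤ n) (hcn : c ≤ n)
    (hs : ∀ j, balanced n (m * (b - a)) j ≤ c) {z₁₁ z₁₂ z₂₂ : ℝ}
    (h11 : 0 < z₁₁) (h11' : z₁₁ < 1) (h12 : 0 < z₁₂) (h12' : z₁₂ < 1)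
    (h22 : 0 < z₂₂) (h22' : z₂₂ < 1)
    (hodds : z₁₁ * z₂₂ * (1 - z₁₂) ^ 2 = z₁₂ ^ 2 * ((1 - z₁₁) * (1 - z₂₂))) :
    ∃ c₀ : ℝ, 0 < c₀ ∧
      (∀ d ∈ tabs (twoStep m n b c) (twoStep m n b c),
        ∏ e : Fin (m + n) × Fin (m + n), berWeight (blockMean m n z₁₁ z₁₂ z₂₂ e) (d e.1 e.2) = c₀) ∧
      Real.exp (-(∑ _i : Fin m, ((a : ℕ) - m * z₁₁) ^ 2 / (m * (z₁₁ * (1 - z₁₁)))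
          + 2 * ∑ _i : Fin m, ((b - a : ℕ) - n * z₁₂) ^ 2 / (n * (z₁₂ * (1 - z₁₂)))
          + ∑ j : Fin n, ((c - balanced n (m * (b - a)) j : ℕ) - n * z₂₂) ^ 2 /
              (n * (z₂₂ * (1 - z₂₂)))
          + 8 * n * Real.log (n + 1)))
        ≤ (tabs (twoStep m n b c) (twoStep m n b c)).card * c₀ := by
  have g11 : 0 < 1 - z₁₁ := by linarith
  have g12 : 0 < 1 - z₁₂ := by linarith
  have g22 : 0 < 1 - z₂₂ := by linarith
  set o₁₁ := z₁₁ / (1 - z₁₁) with ho11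
  set o₂₂ := z₂₂ / (1 - z₂₂) with ho22
  -- Square roots of the diagonal odds serve as the row and column factors; `hodds` says that the
  -- side odds are `α * β`.
  set α := √o₁₁ with hα
  set β := √o₂₂ with hβ
  have hα0 : 0 < α := Real.sqrt_pos.2 (by positivity)
  have hβ0 : 0 < β := Real.sqrt_pos.2 (by positivity)
  have hα2 : α * α = o₁₁ := Real.mul_self_sqrt (by positivity)
  have hβ2 : β * β = o₂₂ := Real.mul_self_sqrt (by positivity)
  have hαβ : α * β = z₁₂ / (1 - z₁₂) := by
    rw [hα, hβ, ← Real.sqrt_mul (by positivity), Real.sqrt_eq_iff_mul_self_eq (by positivity)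
      (by positivity), ho11, ho22]
    field_simp
    linarith
  have e11 : z₁₁ = (1 - z₁₁) * (α * α) := by rw [hα2, ho11]; field_simp
  have e12 : z₁₂ = (1 - z₁₂) * (α * β) := by rw [hαβ]; field_simp
  have e22 : z₂₂ = (1 - z₂₂) * (β * β) := by rw [hβ2, ho22]; field_simp
  set u : Fin (m + n) → ℝ := fun i => if (i : ℕ) < m then α else β with hu
  have hw : ∀ i j, blockMean m n z₁₁ z₁₂ z₂₂ (i, j)
      = (1 - blockMean m n z₁₁ z₁₂ z₂₂ (i, j)) * (u i * u j) := by
    intro i j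
    simp only [blockMean, hu]
    split_ifs
    · exact e11
    · exact e12
    · rw [mul_comm β α]; exact e12
    · exact e22
  set c₀ : ℝ := (1 - z₁₁) ^ (m * m) * (1 - z₁₂) ^ (m * n) * ((1 - z₁₂) ^ (m * n) *
    (1 - z₂₂) ^ (n * n)) * (((α ^ b) ^ m * (β ^ c) ^ n) * ((α ^ b) ^ m * (β ^ c) ^ n)) with hc₀
  refine ⟨c₀, by positivity, fun d hd => ?_, ?_⟩
  · rw [prod_berWeight_of_mem_tabs _ u u hw hd, hc₀]
    simp only [Fin.prod_univ_add, blockMean, hu, twoStep, Fin.val_castAdd, Fin.val_natAdd,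
      Fin.is_lt, if_true, not_lt.2 (Nat.le_add_right _ _), if_false, Finset.prod_const,
      Finset.card_univ, Fintype.card_fin, Finset.prod_mul_distrib]
    ring
  · set t := m * (b - a) with ht
    set s := balanced n t with hsdef
    have hsum : ∑ j, s j = t := sum_balanced hn t
    have htc : t ≤ n * c := by
      rw [← hsum]
      calc ∑ j, s j ≤ ∑ _j : Fin n, c := Finset.sum_le_sum fun j _ => hs j
        _ = n * c := by simp
    have hsum' : ∑ j, (c - s j) = n * c - t := by
      have : ∑ j, (c - s j) + ∑ j, s j = n * c := by
        rw [← Finset.sum_add_distrib, Finset.sum_congr rfl fun j _ => Nat.sub_add_cancel (hs j)]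
        simp
      omega
    have b11 := exp_le_card_tabs_mul (p := m) (q := m) (a := fun _ => a) (b := fun _ => a)
      (fun _ => ham) (fun _ _ => by omega) rfl h11 h11'
    have b12 := exp_le_card_tabs_mul (p := m) (q := n) (a := fun _ => b - a) (b := s)
      (fun _ => hbn) (balanced_le_succ _ _) (by rw [hsum, ht]; simp) h12 h12'
    have b22 := exp_le_card_tabs_mul (p := n) (q := n) (a := fun j => c - s j)
      (b := fun j => c - s j) (fun _ => by omega) (fun j l => by
        have : s l ≤ s j + 1 := balanced_le_succ n t l j
        omega) rfl h22 h22'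
    rw [hsum', pow_mul_pow_eq e22 (by
      calc n * c - t ≤ n * c := Nat.sub_le _ _
        _ ≤ n * n := Nat.mul_le_mul_left _ hcn)] at b22
    simp only [Finset.sum_const, Finset.card_univ, Fintype.card_fin, smul_eq_mul,
      nsmul_eq_mul] at b11 b12 ⊢
    rw [← ht, pow_mul_pow_eq e12 (by rw [ht]; exact Nat.mul_le_mul_left _ hbn)] at b12
    rw [pow_mul_pow_eq e11 (Nat.mul_le_mul_left _ ham)] at b11
    set S₁₁ := (m : ℝ) * (((a : ℕ) - m * z₁₁) ^ 2 / (m * (z₁₁ * (1 - z₁₁))))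
    set S₁₂ := (m : ℝ) * (((b - a : ℕ) - n * z₁₂) ^ 2 / (n * (z₁₂ * (1 - z₁₂))))
    set S₂₂ := ∑ j : Fin n, ((c - s j : ℕ) - n * z₂₂) ^ 2 / (n * (z₂₂ * (1 - z₂₂)))
    set T₁₁ : ℝ := ((tabs (fun _ : Fin m => a) (fun _ : Fin m => a)).card : ℝ)
    set T₁₂ : ℝ := ((tabs (fun _ : Fin m => b - a) s).card : ℝ)
    set T₂₂ : ℝ := ((tabs (fun j => c - s j) (fun j => c - s j)).card : ℝ)
    have hcard : T₁₁ * T₁₂ * T₁₂ * T₂₂ ≤ (tabs (twoStep m n b c) (twoStep m n b c)).card := by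
      have h : ((_ : ℕ) : ℝ) ≤ _ :=
        Nat.cast_le.2 (card_tabs_twoStep (m := m) (n := n) (c := c) hab hs)
      rw [Nat.cast_mul, Nat.cast_mul, Nat.cast_mul] at h
      exact h
    have hT11 : 0 ≤ T₁₁ := Nat.cast_nonneg _
    have hT12 : 0 ≤ T₁₂ := Nat.cast_nonneg _
    have hT22 : 0 ≤ T₂₂ := Nat.cast_nonneg _
    clear_value T₁₁ T₁₂ T₂₂ α β
    have hm1 : (m : ℝ) + 1 ≤ n + 1 := by
      have : (m : ℝ) ≤ n := by exact_mod_cast hmn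
      linarith
    have hn1 : (1 : ℝ) ≤ n + 1 := by
      have : (0 : ℝ) ≤ n := by positivity
      linarith
    have hpw : ∀ x : ℝ, 0 ≤ x → x ≤ n + 1 → ∀ i ≤ n, x ^ i ≤ ((n : ℝ) + 1) ^ n := by
      intro x hx hx1 i hi
      exact (pow_le_pow_left₀ hx hx1 i).trans (pow_le_pow_right₀ hn1 hi)
    have hP : ∀ x y : ℝ, 0 ≤ x → x ≤ n + 1 → 0 ≤ y → y ≤ n + 1 → ∀ i ≤ n, ∀ j ≤ n,
        x ^ i * y ^ j ≤ ((n : ℝ) + 1) ^ (2 * n) := by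
      intro x y hx hx1 hy hy1 i hi j hj
      rw [two_mul, pow_add]
      exact mul_le_mul (hpw x hx hx1 i hi) (hpw y hy hy1 j hj) (by positivity) (by positivity)
    -- A common bound for the polynomial prefactors of each block; the four blocks together cost
    -- `exp (8 n log (n + 1))`.
    set G := ((n : ℝ) + 1) ^ (2 * n) with hG
    have a11 : Real.exp (-S₁₁) ≤ G * (T₁₁ * ((1 - z₁₁) ^ (m * m) * (α * α) ^ (m * a))) :=
      b11.trans (mul_le_mul_of_nonneg_right
        (hP _ _ (by positivity) hm1 (by positivity) hm1 m hmn m hmn) (by positivity))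
    have a12 : Real.exp (-S₁₂) ≤ G * (T₁₂ * ((1 - z₁₂) ^ (m * n) * (α * β) ^ t)) :=
      b12.trans (mul_le_mul_of_nonneg_right
        (hP _ _ (by positivity) hm1 (by positivity) le_rfl n le_rfl m hmn) (by positivity))
    have a22 : Real.exp (-S₂₂) ≤ G * (T₂₂ * ((1 - z₂₂) ^ (n * n) * (β * β) ^ (n * c - t))) :=
      b22.trans (mul_le_mul_of_nonneg_right
        (hP _ _ (by positivity) le_rfl (by positivity) le_rfl n le_rfl n le_rfl) (by positivity))
    have hGe : Real.exp (8 * n * Real.log (n + 1)) = G * G * G * G := by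
      have : (8 : ℝ) * n * Real.log (n + 1) = (8 * n : ℕ) * Real.log (n + 1) := by push_cast; ring
      rw [this, Real.exp_nat_mul, Real.exp_log (by linarith), hG, ← pow_add, ← pow_add, ← pow_add]
      congr 1; ring
    have hG0 : 0 < G := by positivity
    have hαb : (α * α) ^ (m * a) * (α * β) ^ t * (α * β) ^ t * (β * β) ^ (n * c - t)
        = ((α ^ b) ^ m * (β ^ c) ^ n) * ((α ^ b) ^ m * (β ^ c) ^ n) := by
      have x1 : α ^ (m * b) = α ^ (m * a) * α ^ t := by
        rw [← pow_add]; congr 1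
        rw [ht, ← Nat.mul_add, Nat.add_sub_cancel' hab]
      have x2 : β ^ (n * c) = β ^ t * β ^ (n * c - t) := by
        rw [← pow_add]; congr 1; omega
      rw [← pow_mul, ← pow_mul, mul_comm b m, mul_comm c n, x1, x2]
      simp only [mul_pow]
      ring
    rw [show -(S₁₁ + 2 * S₁₂ + S₂₂ + 8 * n * Real.log (n + 1))
        = -S₁₁ + -S₁₂ + -S₁₂ + -S₂₂ - 8 * n * Real.log (n + 1) by ring, Real.exp_sub, hGe,
      div_le_iff₀ (by positivity), Real.exp_add, Real.exp_add, Real.exp_add]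
    calc Real.exp (-S₁₁) * Real.exp (-S₁₂) * Real.exp (-S₁₂) * Real.exp (-S₂₂)
        ≤ (G * (T₁₁ * ((1 - z₁₁) ^ (m * m) * (α * α) ^ (m * a)))) *
          (G * (T₁₂ * ((1 - z₁₂) ^ (m * n) * (α * β) ^ t))) *
          (G * (T₁₂ * ((1 - z₁₂) ^ (m * n) * (α * β) ^ t))) *
          (G * (T₂₂ * ((1 - z₂₂) ^ (n * n) * (β * β) ^ (n * c - t)))) := by gcongr
      _ = (T₁₁ * T₁₂ * T₁₂ * T₂₂) * ((1 - z₁₁) ^ (m * m) * (1 - z₁₂) ^ (m * n) *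
            ((1 - z₁₂) ^ (m * n) * (1 - z₂₂) ^ (n * n)) *
            ((α * α) ^ (m * a) * (α * β) ^ t * (α * β) ^ t * (β * β) ^ (n * c - t))) *
            (G * G * G * G) := by ring
      _ ≤ _ := by
          rw [hαb, ← hc₀]
          gcongr

/-! ### Bounds for the row laws at fixed `n`. -/

theorem entry_add_one {N : ℕ} (d : Fin N → Fin N → Fin 2) {i j : ℕ} (hi : i < N) (hj : j < N) :
    entry d (i + 1) (j + 1) = d ⟨i, hi⟩ ⟨j, hj⟩ := by
  rw [entry, dif_pos ⟨⟨by omega, by omega⟩, by omega, by omega⟩]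
  rfl

theorem margin_eq_twoStep (n : ℕ) (δ B C : ℝ) :
    margin n δ B C = twoStep (topSize n δ) n ⌊B * C * n⌋₊ ⌊C * n⌋₊ := rfl

/-- The first `m` entries of the row take at most `m` of its sum and rounding costs at most `1`, so
the other `n` exchangeable entries have mean within `(m + 1) / n` of `C`. -/
theorem dTV_bottomRight_le {n k : ℕ} {δ B C : ℝ} (hn : 0 < n) (hC : 0 ≤ C) (hC1 : C ≤ 1)
    (hk : k ≤ n) (hne : (tabs (margin n δ B C) (margin n δ B C)).Nonempty) :
    dTV (rowLaw n δ B C (topSize n δ + 1) (topSize n δ) k) (iidBer k C)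
      ≤ 2 * (k / ((n - k : ℕ) + 1)) + 2 * k * ((topSize n δ + 1) / n) := by
  rw [dTV_rowLaw_iidBer n δ B C _ _ k hC hC1]
  set m := topSize n δ
  obtain ⟨l, rfl⟩ := Nat.exists_eq_add_of_le hk
  rw [Nat.add_sub_cancel_left]
  set M := tabs (margin (k + l) δ B C) (margin (k + l) δ B C) with hM
  let f : Fin (k + l) → Fin (m + (k + l)) := fun s => Fin.natAdd m s
  have hf : Function.Injective f := Fin.natAdd_injective _ _
  let i : Fin (m + (k + l)) := ⟨m, by omega⟩
  have h := sum_abs_sub_le_of_exchangeable M hne (fun d s => d i (f s)) (fun y y' hyy =>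
    card_filter_row_eq_of_sum_eq _ _ i hf (v := ⌊C * (k + l : ℕ)⌋₊)
      (fun s => twoStep_natAdd s) hyy) hC hC1 (η := (m + 1) / (k + l : ℕ)) (fun d hd => by
        have h1 := (mem_tabs.1 hd).1 i
        have h2 : margin (k + l) δ B C i = ⌊C * (k + l : ℕ)⌋₊ := by
          rw [margin_eq_twoStep]; exact if_neg (lt_irrefl _)
        rw [h2, Fin.sum_univ_add] at h1
        have h3 : ∑ j : Fin m, (d i (Fin.castAdd (k + l) j) : ℕ) ≤ m :=
          sum_val_le fun j : Fin m => d i (Fin.castAdd (k + l) j)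
        have hn' : (0 : ℝ) < (k + l : ℕ) := by exact_mod_cast hn
        have h4 := Nat.floor_le (show 0 ≤ C * (k + l : ℕ) by positivity)
        have h5 := Nat.lt_floor_add_one (C * (k + l : ℕ))
        set S := ∑ j, (d i (f j) : ℕ) with hS
        have h1' : ((∑ j : Fin m, (d i (Fin.castAdd (k + l) j) : ℕ) : ℕ) : ℝ) + (S : ℝ)
            = (⌊C * (k + l : ℕ)⌋₊ : ℝ) := by exact_mod_cast h1
        have h3' : ((∑ j : Fin m, (d i (Fin.castAdd (k + l) j) : ℕ) : ℕ) : ℝ) ≤ m := by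
          exact_mod_cast h3
        have h6 : (0 : ℝ) ≤ ((∑ j : Fin m, (d i (Fin.castAdd (k + l) j) : ℕ) : ℕ) : ℝ) :=
          Nat.cast_nonneg _
        rw [abs_le]
        constructor
        · rw [neg_le_sub_iff_le_add, ← add_div, le_div_iff₀ hn']; linarith
        · rw [sub_le_iff_le_add, div_le_iff₀ hn', add_mul, div_mul_cancel₀ _ hn'.ne']; linarith)
  refine le_trans (le_of_eq ?_) h
  refine Finset.sum_congr rfl fun x _ => ?_
  congr 5
  ext d
  simp only [Finset.mem_filter]
  refine and_congr_right fun _ => ?_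
  have : (fun t : Fin k => entry d (m + 1) (m + ((t : ℕ) + 1)))
      = fun t : Fin k => d i (f (Fin.castAdd l t)) := by
    funext t
    exact entry_add_one (j := m + (t : ℕ)) d (by omega : m < m + (k + l)) (by omega)
  rw [this]

/-- The `W` columns after the first `j` are cut into segments in each of the top rows. These are
disjoint and equidistributed, so `sum_abs_sub_le_of_blocks` applies to the one that starts row `1`.
-/
theorem dTV_topRow_le {n k j W v : ℕ} {δ B C : ℝ} (hm : 0 < topSize n δ)
    (hjW : j + W ≤ topSize n δ + n)
    (hv : ∀ y : Fin (topSize n δ + n), j ≤ y → (y : ℕ) < j + W → margin n δ B C y = v)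
    {z₁₁ z₁₂ z₂₂ z : ℝ} (h11 : 0 ≤ z₁₁) (h11' : z₁₁ ≤ 1) (h12 : 0 ≤ z₁₂) (h12' : z₁₂ ≤ 1)
    (h22 : 0 ≤ z₂₂) (h22' : z₂₂ ≤ 1) (hz0 : 0 ≤ z) (hz1 : z ≤ 1)
    (hz : ∀ i y : Fin (topSize n δ + n), (i : ℕ) < topSize n δ → j ≤ y → (y : ℕ) < j + W →
      blockMean (topSize n δ) n z₁₁ z₁₂ z₂₂ (i, y) = z)
    {c₀ L : ℝ} (hc₀ : 0 < c₀)
    (hc : ∀ d ∈ tabs (margin n δ B C) (margin n δ B C),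
      ∏ e : Fin (topSize n δ + n) × Fin (topSize n δ + n),
        berWeight (blockMean (topSize n δ) n z₁₁ z₁₂ z₂₂ e) (d e.1 e.2) = c₀)
    (hL : Real.exp (-L) ≤ (tabs (margin n δ B C) (margin n δ B C)).card * c₀)
    (hL0 : 0 < L) (hLJ : L ≤ (topSize n δ * (W / (k + 1)) : ℕ)) :
    dTV (rowLaw n δ B C 1 j k) (iidBer k z) ≤ 4 * √(L / (topSize n δ * (W / (k + 1)) : ℕ)) := by
  rw [dTV_rowLaw_iidBer n δ B C _ _ k hz0 hz1]
  set m := topSize n δ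
  set M := tabs (margin n δ B C) (margin n δ B C) with hM
  have hMne : M.Nonempty := by
    rw [← Finset.card_pos]
    by_contra! h
    have h0 : M.card = 0 := by omega
    rw [h0, Nat.cast_zero, zero_mul] at hL
    exact absurd hL (not_le.2 (Real.exp_pos _))
  have hMc : (0 : ℝ) < M.card := by exact_mod_cast hMne.card_pos
  -- Segments of length `k + 1`, with the last column of each left idle, so that `k = 0` needs no
  -- separate treatment.
  set q := W / (k + 1) with hq
  have hcol : ∀ t < q, ∀ s < k, t * (k + 1) + s < W := by
    intro t ht s hs
    calc t * (k + 1) + s < (t + 1) * (k + 1) := by rw [add_mul]; omega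
      _ ≤ q * (k + 1) := Nat.mul_le_mul_right _ ht
      _ ≤ W := Nat.div_mul_le_self _ _
  have hcard : Fintype.card (Fin m × Fin q) = m * q := by simp
  have hq0 : 0 < q := by
    rcases Nat.eq_zero_or_pos q with h | h
    · rw [h, mul_zero, Nat.cast_zero] at hLJ; linarith
    · exact h
  let col : Fin q → Fin k → Fin (m + n) := fun t s =>
    ⟨j + (t * (k + 1) + s), by have := hcol t t.2 s s.2; omega⟩
  have hcol1 : ∀ t s, j ≤ (col t s : ℕ) := fun t s => Nat.le_add_right _ _
  have hcol2 : ∀ t s, (col t s : ℕ) < j + W := fun t s =>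
    Nat.add_lt_add_left (hcol t t.2 s s.2) j
  have hcolinj : ∀ t t' s s', col t s = col t' s' → t = t' ∧ s = s' := by
    intro t t' s s' h
    have h1 : (t : ℕ) * (k + 1) + s = t' * (k + 1) + s' := by
      have := congrArg Fin.val h
      simp only [col] at this
      omega
    have h2 : (t : ℕ) = t' := by
      have e : ∀ (t : Fin q) (s : Fin k), ((t : ℕ) * (k + 1) + s) / (k + 1) = t := by
        intro t s
        rw [mul_comm, Nat.mul_add_div (Nat.succ_pos k), Nat.div_eq_of_lt (by omega), add_zero]
      rw [← e t s, h1, e]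
    rw [h2] at h1
    exact ⟨Fin.ext h2, Fin.ext (by omega)⟩
  let Φ : (Fin m × Fin q) × Fin k ↪ Fin (m + n) × Fin (m + n) :=
    ⟨fun x => (Fin.castAdd n x.1.1, col x.1.2 x.2), by
      rintro ⟨⟨i, t⟩, s⟩ ⟨⟨i', t'⟩, s'⟩ h
      simp only [Prod.mk.injEq] at h
      obtain ⟨h1, h2⟩ := h
      obtain ⟨rfl, rfl⟩ := hcolinj _ _ _ _ h2
      rw [Fin.castAdd_injective _ _ h1]⟩
  let i₀ : Fin (m + n) := ⟨0, by omega⟩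
  have hrow : ∀ x : Fin k → Fin 2, (M.filter fun d =>
      (fun t : Fin k => entry d 1 (j + ((t : ℕ) + 1))) = x)
      = M.filter fun d => (fun s => d i₀ (col ⟨0, hq0⟩ s)) = x := by
    intro x
    ext d
    simp only [Finset.mem_filter]
    refine and_congr_right fun _ => ?_
    have : (fun t : Fin k => entry d 1 (j + ((t : ℕ) + 1)))
        = fun s => d i₀ (col ⟨0, hq0⟩ s) := by
      funext s
      have := hcol 0 hq0 s s.2
      rw [← add_assoc, entry_add_one d (by omega : 0 < m + n) (by omega : j + (s : ℕ) < m + n)]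
      congr 1
      simp [col]
    rw [this]
  simp_rw [hrow]
  have h := sum_abs_sub_le_of_blocks (fun d : Fin (m + n) → Fin (m + n) → Fin 2 =>
      fun e : Fin (m + n) × Fin (m + n) => d e.1 e.2)
    (fun d d' h => funext fun a => funext fun b => congrFun h (a, b)) M hMne
    (blockMean m n z₁₁ z₁₂ z₂₂)
    (fun e => by rw [blockMean]; split_ifs <;> assumption)
    (fun e => by rw [blockMean]; split_ifs <;> assumption) hc₀ hc hL Φ (z := z)
    (fun x => hz _ _ x.1.1.2 (hcol1 _ _) (hcol2 _ _)) hz0 hz1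
    (fun x => ((M.filter fun d => (fun s => d i₀ (col ⟨0, hq0⟩ s)) = x).card : ℝ) / M.card)
    (fun t x => by
      rw [mul_div_cancel₀ _ hMc.ne']
      congr 1
      refine card_filter_tabs_eq _ _ (v := v) (i := Fin.castAdd n t.1) (i' := i₀) (f := col t.2)
        (g := col ⟨0, hq0⟩) ?_ (fun s s' h => (hcolinj _ _ _ _ h).2)
        (fun s s' h => (hcolinj _ _ _ _ h).2) (fun s => hv _ (hcol1 _ _) (hcol2 _ _))
        (fun s => hv _ (hcol1 _ _) (hcol2 _ _)) x
      rw [margin_eq_twoStep]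
      exact (twoStep_castAdd t.1).trans (if_pos hm).symm)
    (by
      rw [← Finset.sum_div, div_eq_one_iff_eq hMc.ne', ← Nat.cast_sum]
      congr 1
      exact (Finset.card_eq_sum_card_fiberwise
        fun _ _ => Finset.mem_coe.2 (Finset.mem_univ _)).symm)
    hL0 (by rw [hcard]; exact hLJ)
  rw [hcard] at h
  exact h

/-! ### Choice of the block means and size of the margin deviations. -/

/-- The mean in the top left block that makes the odds of product form, if the means in the side
blocks are `z` and the mean in the bottom right block is `y`. -/
noncomputable def oddsMean (z y : ℝ) : ℝ := z ^ 2 * (1 - y) / (z ^ 2 * (1 - y) + (1 - z) ^ 2 * y)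

theorem topLeftMean_eq_oddsMean {B C : ℝ} (hC : 0 < C) :
    topLeftMean B C = oddsMean (B * C) C := by
  have h : (B * C) ^ 2 * (1 - C) + (1 - B * C) ^ 2 * C = C ^ 2 * (B ^ 2 - 2 * B + 1 / C) := by
    field_simp; ring
  rw [oddsMean, h, topLeftMean, mul_pow, mul_comm (B ^ 2) (C ^ 2), mul_assoc,
    mul_div_mul_left _ _ (by positivity)]

/-- A lower bound, uniform in `y`, for the denominator of `oddsMean`. -/
theorem sq_mul_sq_le {z y : ℝ} (hz : 0 < z) (hz1 : z < 1) (hy : 0 ≤ y) (hy1 : y ≤ 1) :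
    z ^ 2 * (1 - z) ^ 2 ≤ z ^ 2 * (1 - y) + (1 - z) ^ 2 * y := by
  have hp1 : z ^ 2 ≤ 1 := pow_le_one₀ hz.le hz1.le
  have hr1 : (1 - z) ^ 2 ≤ 1 := pow_le_one₀ (by linarith) (by linarith)
  have h1 : z ^ 2 * (1 - z) ^ 2 * (1 - y) ≤ z ^ 2 * (1 - y) :=
    mul_le_mul_of_nonneg_right (mul_le_of_le_one_right (sq_nonneg z) hr1) (by linarith)
  have h2 : z ^ 2 * (1 - z) ^ 2 * y ≤ (1 - z) ^ 2 * y :=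
    mul_le_mul_of_nonneg_right (mul_le_of_le_one_left (sq_nonneg _) hp1) hy
  linarith

/-- The denominator is a convex combination of `z ^ 2` and `(1 - z) ^ 2`, hence at most `1`, so
dropping it gives lower bounds. The last clause is the odds condition of `exp_le_card_tabs_twoStep`.
-/
theorem oddsMean_bounds {z y : ℝ} (hz : 0 < z) (hz1 : z < 1) (hy : 0 < y) (hy1 : y < 1) :
    z ^ 2 * (1 - y) ≤ oddsMean z y ∧ (1 - z) ^ 2 * y ≤ 1 - oddsMean z y ∧
      oddsMean z y * y * (1 - z) ^ 2 = z ^ 2 * ((1 - oddsMean z y) * (1 - y)) := by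
  have hz' : 0 < 1 - z := by linarith
  have hy' : 0 < 1 - y := by linarith
  have hp1 : z ^ 2 ≤ 1 := pow_le_one₀ hz.le hz1.le
  have hr1 : (1 - z) ^ 2 ≤ 1 := pow_le_one₀ hz'.le (by linarith)
  have hD0 : 0 < z ^ 2 * (1 - y) + (1 - z) ^ 2 * y := by positivity
  have hD1 : z ^ 2 * (1 - y) + (1 - z) ^ 2 * y ≤ 1 := by nlinarith
  have h1 : 1 - oddsMean z y = (1 - z) ^ 2 * y / (z ^ 2 * (1 - y) + (1 - z) ^ 2 * y) := by
    rw [oddsMean, eq_div_iff hD0.ne', sub_mul, div_mul_cancel₀ _ hD0.ne']; ring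
  refine ⟨?_, ?_, ?_⟩
  · rw [oddsMean]
    exact le_div_self (by positivity) hD0 hD1
  · rw [h1]
    exact le_div_self (by positivity) hD0 hD1
  · rw [h1, oddsMean]; ring

/-- In the difference the numerator collapses to `z ^ 2 * (1 - z) ^ 2 * (C - y)`, and both
denominators are bounded below by `sq_mul_sq_le`. -/
theorem abs_oddsMean_sub_le {z y C : ℝ} (hz : 0 < z) (hz1 : z < 1) (hy : 0 < y) (hyC : y ≤ C)
    (hC : C < 1) : |oddsMean z y - oddsMean z C| ≤ 1 / (z ^ 2 * (1 - z) ^ 2) * (C - y) := by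
  have hz' : 0 < 1 - z := by linarith
  have hp : 0 < z ^ 2 * (1 - z) ^ 2 := by positivity
  have h1 := sq_mul_sq_le hz hz1 hy.le (by linarith)
  have h2 := sq_mul_sq_le hz hz1 (hy.le.trans hyC) hC.le
  have hCy : 0 ≤ C - y := by linarith
  have hD := hp.trans_le h1
  have hD' := hp.trans_le h2
  have e : oddsMean z y - oddsMean z C = z ^ 2 * (1 - z) ^ 2 * (C - y) /
      ((z ^ 2 * (1 - y) + (1 - z) ^ 2 * y) * (z ^ 2 * (1 - C) + (1 - z) ^ 2 * C)) := by
    rw [oddsMean, oddsMean, div_sub_div _ _ hD.ne' hD'.ne']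
    congr 1
    ring
  rw [e, abs_of_nonneg (by positivity)]
  calc _ ≤ z ^ 2 * (1 - z) ^ 2 * (C - y) / ((z ^ 2 * (1 - z) ^ 2) * (z ^ 2 * (1 - z) ^ 2)) := by
        gcongr
    _ = _ := by field_simp

/-- Only the rounding of `m * x` to `a` contributes, so the sum stays bounded. -/
theorem sum_topLeft_deviation_le {m a : ℕ} {x ε : ℝ} (hm : 0 < m) (ha1 : (a : ℝ) ≤ m * x)
    (ha2 : m * x < a + 1) (hε : 0 < ε) (hx : ε ≤ x * (1 - x)) :
    ∑ _i : Fin m, ((a : ℝ) - m * x) ^ 2 / (m * (x * (1 - x))) ≤ 1 / ε := by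
  have hm0 : (0 : ℝ) < m := by exact_mod_cast hm
  rw [Finset.sum_const, Finset.card_univ, Fintype.card_fin, nsmul_eq_mul]
  have hx0 : 0 < x * (1 - x) := hε.trans_le hx
  calc (m : ℝ) * (((a : ℝ) - m * x) ^ 2 / (m * (x * (1 - x))))
      = ((a : ℝ) - m * x) ^ 2 / (x * (1 - x)) := by field_simp
    _ ≤ 1 / ε := by
        gcongr
        exact (sq_le_one_iff_abs_le_one _).2 (abs_le.2 ⟨by linarith, by linarith⟩)

/-- A side row sum misses `n * z` by at most `m + 1 ≤ 2 * m`, mainly because `a` units lie in the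
top left block. The sum is of order `m ^ 3 / n`, which is `O(n)` by `m ^ 3 ≤ n ^ 2`; this is where
`δ ≤ 2 / 3` enters. -/
theorem sum_side_deviation_le {m n a b : ℕ} {z : ℝ} (hm : 1 ≤ m) (hn : 0 < n)
    (hmn : (m : ℝ) ^ 3 ≤ n ^ 2) (ham : a ≤ m) (hab : a ≤ b) (hz : 0 < z) (hz1 : z < 1)
    (hb1 : (b : ℝ) ≤ z * n) (hb2 : z * n < b + 1) :
    ∑ _i : Fin m, (((b - a : ℕ) : ℝ) - n * z) ^ 2 / (n * (z * (1 - z)))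
      ≤ 4 / (z * (1 - z)) * n := by
  have hn0 : (0 : ℝ) < n := by exact_mod_cast hn
  have hm1 : (1 : ℝ) ≤ m := by exact_mod_cast hm
  have ham' : (a : ℝ) ≤ m := by exact_mod_cast ham
  have ha0 : (0 : ℝ) ≤ a := Nat.cast_nonneg _
  have hz' : 0 < 1 - z := by linarith
  rw [Finset.sum_const, Finset.card_univ, Fintype.card_fin, nsmul_eq_mul, Nat.cast_sub hab]
  have h1 : ((b : ℝ) - a - n * z) ^ 2 ≤ (2 * m) ^ 2 := by
    apply sq_le_sq' <;> linarith
  calc (m : ℝ) * (((b : ℝ) - a - n * z) ^ 2 / (n * (z * (1 - z))))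
      ≤ m * ((2 * m) ^ 2 / (n * (z * (1 - z)))) := by gcongr
    _ = 4 * (m ^ 3 / (n * (z * (1 - z)))) := by ring
    _ ≤ 4 * (n ^ 2 / (n * (z * (1 - z)))) := by gcongr
    _ = 4 / (z * (1 - z)) * n := by field_simp

/-- The mean `C - m / n * z` already allows for the units in the side block. There remain two
roundings, and the shift due to `a` and to the rounding of `z * n`, which is at most `m * (m + 1) /
n`. -/
theorem abs_bottomRight_deviation_le {m n a b c : ℕ} {z C : ℝ} (hm : 1 ≤ m) (hn : 0 < n)
    (ham : a ≤ m) (hab : a ≤ b) (hb1 : (b : ℝ) ≤ z * n) (hb2 : z * n < b + 1)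
    (hc1 : (c : ℝ) ≤ C * n) (hc2 : C * n < c + 1) (hs : ∀ j, balanced n (m * (b - a)) j ≤ c)
    (j : Fin n) :
    |((c - balanced n (m * (b - a)) j : ℕ) : ℝ) - n * (C - m / n * z)| ≤ 2 + 2 * m ^ 2 / n := by
  have hn0 : (0 : ℝ) < n := by exact_mod_cast hn
  have hm1 : (1 : ℝ) ≤ m := by exact_mod_cast hm
  have ham' : (a : ℝ) ≤ m := by exact_mod_cast ham
  have ha0 : (0 : ℝ) ≤ a := Nat.cast_nonneg _
  have htR : ((m * (b - a) : ℕ) : ℝ) = m * (b - a) := by rw [Nat.cast_mul, Nat.cast_sub hab]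
  rw [Nat.cast_sub (hs j)]
  generalize m * (b - a) = t at htR hs ⊢
  have ht1 : (n : ℝ) * (t / n : ℕ) ≤ t := by exact_mod_cast Nat.mul_div_le t n
  have ht2 : (t : ℝ) ≤ n * ((t / n : ℕ) + 1) := by
    exact_mod_cast (Nat.lt_mul_div_succ t hn).le
  have hny : (n : ℝ) * (C - m / n * z) = C * n - m * z := by field_simp
  rw [hny]
  have l1 : (balanced n t j : ℝ) ≤ (t / n : ℕ) + 1 := by exact_mod_cast balanced_le n t j
  have l2 : ((t / n : ℕ) : ℝ) ≤ balanced n t j := by exact_mod_cast le_balanced n t j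
  have l3 : (t : ℝ) / n ≤ (t / n : ℕ) + 1 := by rw [div_le_iff₀ hn0]; linarith
  have l4 : ((t / n : ℕ) : ℝ) ≤ (t : ℝ) / n := by rw [le_div_iff₀ hn0]; linarith
  have l5 : m * z - t / n = m * (z * n - b + a) / n := by rw [htR]; field_simp; ring
  have l6 : 0 ≤ m * z - t / n := by
    rw [l5]
    have : 0 ≤ z * n - b + a := by linarith
    positivity
  have l7 : m * z - t / n ≤ 2 * m ^ 2 / n := by
    rw [l5]
    have : m * (z * n - b + a) ≤ m * (2 * m) := by gcongr; linarith
    rw [div_le_div_iff_of_pos_right hn0]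
    linarith
  rw [abs_le]
  constructor <;> linarith

/-- Each squared deviation is at most `8 + 8 * m ^ 4 / n ^ 2`, hence `O(n)`, because `m ^ 4 ≤ n ^
3`. -/
theorem sum_bottomRight_deviation_le {m n : ℕ} {f : Fin n → ℝ} {y ε : ℝ} (hn : 1 ≤ n)
    (hmn : (m : ℝ) ^ 3 ≤ n ^ 2) (hmn' : (m : ℝ) ≤ n) (hf : ∀ j, |f j - n * y| ≤ 2 + 2 * m ^ 2 / n)
    (hε : 0 < ε) (hy : ε ≤ y * (1 - y)) :
    ∑ j, (f j - n * y) ^ 2 / (n * (y * (1 - y))) ≤ 16 / ε * n := by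
  have hn0 : (0 : ℝ) < n := by exact_mod_cast hn
  have hn1 : (1 : ℝ) ≤ n := by exact_mod_cast hn
  have hm4 : (m : ℝ) ^ 4 / n ^ 2 ≤ n := by
    rw [div_le_iff₀ (by positivity)]
    calc (m : ℝ) ^ 4 = (m : ℝ) ^ 3 * m := by ring
      _ ≤ (n : ℝ) ^ 2 * n := by gcongr
      _ = _ := by ring
  calc ∑ j, (f j - n * y) ^ 2 / (n * (y * (1 - y)))
      ≤ ∑ _j : Fin n, (16 * n : ℝ) / (n * ε) := by
        refine Finset.sum_le_sum fun j _ => ?_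
        have h1 : (f j - n * y) ^ 2 ≤ 16 * n := by
          calc (f j - n * y) ^ 2 ≤ (2 + 2 * m ^ 2 / n) ^ 2 := sq_le_sq.2 (by
                rw [abs_of_nonneg (show (0 : ℝ) ≤ 2 + 2 * m ^ 2 / n by positivity)]
                exact hf j)
            _ ≤ 8 + 8 * (m ^ 4 / n ^ 2) := by
                have : (m : ℝ) ^ 4 / n ^ 2 = (m ^ 2 / n) ^ 2 := by rw [div_pow]; ring
                rw [this, mul_div_assoc]
                nlinarith [sq_nonneg ((m : ℝ) ^ 2 / n - 1)]
            _ ≤ 16 * n := by linarith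
        gcongr
    _ = 16 / ε * n := by
        rw [Finset.sum_const, Finset.card_univ, Fintype.card_fin, nsmul_eq_mul]
        field_simp

theorem log_add_one_le {x : ℝ} (hx : 2 ≤ x) : Real.log (x + 1) ≤ 2 * Real.log x := by
  have : (2 : ℝ) * Real.log x = Real.log (x ^ 2) := by rw [Real.log_pow]; norm_num
  rw [this]
  apply Real.log_le_log (by positivity)
  nlinarith

/-- Product-form Bernoulli means with nearly correct expected margins: all tables have the same
weight, and their total weight is at least `exp (-K n log n)`. -/
theorem exists_blockMean {B C : ℝ} (hB : 0 < B) (hC : 0 < C) (hC1 : C < 1) (hBC : B * C < 1) :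
    ∃ K : ℝ, 0 < K ∧ ∀ m n : ℕ, 3 ≤ n → 1 ≤ m → (m : ℝ) ^ 3 ≤ n ^ 2 → m ≤ n →
      (m + 2 : ℝ) ≤ B * C * n → (m + 2 : ℝ) ≤ C * n → (m : ℝ) * (2 * B) ≤ n →
      ∃ z₁₁ z₂₂ : ℝ, 0 < z₁₁ ∧ z₁₁ < 1 ∧ 0 < z₂₂ ∧ z₂₂ < 1 ∧
        |z₁₁ - topLeftMean B C| ≤ K * (m / n) ∧
        ∃ c₀ : ℝ, 0 < c₀ ∧
          (∀ d ∈ tabs (twoStep m n ⌊B * C * n⌋₊ ⌊C * n⌋₊) (twoStep m n ⌊B * C * n⌋₊ ⌊C * n⌋₊),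
            ∏ e : Fin (m + n) × Fin (m + n),
              berWeight (blockMean m n z₁₁ (B * C) z₂₂ e) (d e.1 e.2) = c₀) ∧
          Real.exp (-(K * (n * Real.log n))) ≤
            (tabs (twoStep m n ⌊B * C * n⌋₊ ⌊C * n⌋₊)
              (twoStep m n ⌊B * C * n⌋₊ ⌊C * n⌋₊)).card * c₀ := by
  have hz0 : 0 < B * C := by positivity
  rw [topLeftMean_eq_oddsMean hC]
  obtain ⟨z, hz⟩ : ∃ z, z = B * C := ⟨_, rfl⟩
  rw [← hz] at hBC hz0 ⊢
  have hz0' : 0 < 1 - z := by linarith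
  have hCC : 0 < 1 - C := by linarith
  obtain ⟨K₁, hK₁⟩ : ∃ K, K = 1 / ((z ^ 2 * (1 - C)) * ((1 - z) ^ 2 * (C / 2))) := ⟨_, rfl⟩
  obtain ⟨K₂, hK₂⟩ : ∃ K, K = 4 / (z * (1 - z)) := ⟨_, rfl⟩
  obtain ⟨K₃, hK₃⟩ : ∃ K, K = 16 / ((C / 2) * (1 - C)) := ⟨_, rfl⟩
  obtain ⟨K₄, hK₄⟩ : ∃ K, K = 1 / (z ^ 2 * (1 - z) ^ 2) := ⟨_, rfl⟩
  have hK1 : 0 < K₁ := by rw [hK₁]; positivity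
  have hK2 : 0 < K₂ := by rw [hK₂]; positivity
  have hK3 : 0 < K₃ := by rw [hK₃]; positivity
  have hK4 : 0 < K₄ := by rw [hK₄]; positivity
  -- `K₁`, `K₂`, `K₃` bound the deviations of the blocks, the side block counting twice; `K₄` is the
  -- Lipschitz constant of `oddsMean`; `16` absorbs the prefactors `8 n log (n + 1)`.
  refine ⟨K₁ + 2 * K₂ + K₃ + K₄ + 16, by positivity, ?_⟩
  intro m n hn hm hmn3 hmn hb hc hB2
  have hn3 : (3 : ℝ) ≤ n := by exact_mod_cast hn
  have hn0 : (0 : ℝ) < n := by linarith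
  have hm1 : (1 : ℝ) ≤ m := by exact_mod_cast hm
  have hm0 : (0 : ℝ) < m := by linarith
  have hmn' : (m : ℝ) ≤ n := by exact_mod_cast hmn
  have hCy0 : 0 < m / n * z := by positivity
  have hCy1 : m / n * z ≤ C / 2 := by
    rw [div_mul_eq_mul_div, div_le_iff₀ hn0, hz]
    have := mul_le_mul_of_nonneg_right hB2 hC.le
    linarith
  -- The side blocks keep the mean `B * C` exactly; the bottom right mean is lowered to give the
  -- bottom rows nearly the right expected sum, and the top left mean is then forced by the odds.
  obtain ⟨y, hy⟩ : ∃ y, y = C - m / n * z := ⟨_, rfl⟩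
  have hyC : y ≤ C := by linarith
  have hy2 : C / 2 ≤ y := by linarith
  have hy0 : 0 < y := by linarith
  have hy1 : y < 1 := by linarith
  obtain ⟨hxl, hxu, hodds⟩ := oddsMean_bounds hz0 hBC hy0 hy1
  have hxd := abs_oddsMean_sub_le hz0 hBC hy0 hyC hC1
  generalize oddsMean z y = x at hxl hxu hodds hxd
  have hxl' : z ^ 2 * (1 - C) ≤ x := le_trans (by gcongr) hxl
  have hxu' : (1 - z) ^ 2 * (C / 2) ≤ 1 - x := le_trans (by gcongr) hxu
  have hx0 : 0 < x := lt_of_lt_of_le (by positivity) hxl'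
  have hx1 : 0 < 1 - x := lt_of_lt_of_le (by positivity) hxu'
  refine ⟨x, y, hx0, by linarith, hy0, hy1, ?_, ?_⟩
  · refine hxd.trans ?_
    rw [← hK₄, show C - y = m / n * z by rw [hy]; ring]
    have h1 : (m : ℝ) / n * z ≤ m / n := mul_le_of_le_one_right (by positivity) hBC.le
    exact mul_le_mul (by linarith) h1 hCy0.le (by positivity)
  · obtain ⟨b, hbdef⟩ : ∃ b, b = ⌊z * n⌋₊ := ⟨_, rfl⟩
    obtain ⟨c, hcdef⟩ : ∃ c, c = ⌊C * n⌋₊ := ⟨_, rfl⟩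
    obtain ⟨a, hadef⟩ : ∃ a, a = ⌊m * x⌋₊ := ⟨_, rfl⟩
    have hb1 : (b : ℝ) ≤ z * n := hbdef ▸ Nat.floor_le (by positivity)
    have hb2 : z * n < b + 1 := hbdef ▸ Nat.lt_floor_add_one _
    have hc1 : (c : ℝ) ≤ C * n := hcdef ▸ Nat.floor_le (by positivity)
    have hc2 : C * n < c + 1 := hcdef ▸ Nat.lt_floor_add_one _
    have ha1 : (a : ℝ) ≤ m * x := hadef ▸ Nat.floor_le (by positivity)
    have ha2 : m * x < a + 1 := hadef ▸ Nat.lt_floor_add_one _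
    rw [← hbdef, ← hcdef]
    have ham : a ≤ m := by
      have : (a : ℝ) ≤ m := ha1.trans (mul_le_of_le_one_right hm0.le (by linarith))
      exact_mod_cast this
    have hmb : m ≤ b := by
      have : (m : ℝ) ≤ b := by linarith
      exact_mod_cast this
    have hab : a ≤ b := ham.trans hmb
    have hbn : b ≤ n := by
      have : (b : ℝ) ≤ n := hb1.trans (mul_le_of_le_one_left hn0.le hBC.le)
      exact_mod_cast this
    have hcn : c ≤ n := by
      have : (c : ℝ) ≤ n := hc1.trans (mul_le_of_le_one_left hn0.le hC1.le)
      exact_mod_cast this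
    have hmc : m + 1 ≤ c := by
      have : (m + 1 : ℝ) ≤ c := by linarith
      exact_mod_cast this
    have hnpos : 0 < n := by omega
    have htm : m * (b - a) / n ≤ m := by
      calc m * (b - a) / n ≤ m * n / n := Nat.div_le_div_right (Nat.mul_le_mul_left _ (by omega))
        _ = m := Nat.mul_div_cancel _ hnpos
    have hs : ∀ j, balanced n (m * (b - a)) j ≤ c := fun j =>
      (balanced_le _ _ j).trans (by omega)
    obtain ⟨c₀, hc₀, hconst, hexp⟩ := exp_le_card_tabs_twoStep (m := m) (n := n) (a := a) (b := b)
      (c := c) hnpos hmn ham hab (by omega) hcn hs hx0 (by linarith : x < 1) hz0 hBC hy0 hy1 hodds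
    refine ⟨c₀, hc₀, hconst, le_trans (Real.exp_le_exp.2 (neg_le_neg ?_)) hexp⟩
    have hS11 := sum_topLeft_deviation_le (by omega) ha1 ha2
      (show 0 < (z ^ 2 * (1 - C)) * ((1 - z) ^ 2 * (C / 2)) by positivity)
      (mul_le_mul hxl' hxu' (by positivity) hx0.le)
    have hS12 := sum_side_deviation_le hm hnpos hmn3 ham hab hz0 hBC hb1 hb2
    have hS22 := sum_bottomRight_deviation_le (m := m) (n := n) (y := y) (by omega) hmn3 hmn'
      (by rw [hy]; exact abs_bottomRight_deviation_le hm hnpos ham hab hb1 hb2 hc1 hc2 hs)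
      (show 0 < (C / 2) * (1 - C) by positivity)
      (mul_le_mul hy2 (by linarith) hCC.le hy0.le)
    rw [← hK₁] at hS11
    rw [← hK₂] at hS12
    rw [← hK₃] at hS22
    have hlog1 : 1 ≤ Real.log n := by
      rw [Real.le_log_iff_exp_le hn0]
      exact (Real.exp_one_lt_d9.le.trans (by norm_num)).trans hn3
    have hnlog : (n : ℝ) ≤ n * Real.log n := le_mul_of_one_le_right hn0.le hlog1
    have h8 : 8 * n * Real.log (n + 1) ≤ 16 * (n * Real.log n) := by
      have := mul_le_mul_of_nonneg_left (log_add_one_le (by linarith : (2 : ℝ) ≤ n))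
        (show (0 : ℝ) ≤ 8 * n by positivity)
      calc _ ≤ _ := this
        _ = _ := by ring
    have hn1 : 1 ≤ n * Real.log n := le_trans (by linarith) hnlog
    have f1 : K₁ ≤ K₁ * (n * Real.log n) := le_mul_of_one_le_right hK1.le hn1
    have f2 : K₂ * n ≤ K₂ * (n * Real.log n) := by gcongr
    have f3 : K₃ * n ≤ K₃ * (n * Real.log n) := by gcongr
    have f4 : 0 ≤ K₄ * (n * Real.log n) := by positivity
    calc _ ≤ K₁ + 2 * (K₂ * n) + K₃ * n + 16 * (n * Real.log n) := by gcongr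
      _ ≤ K₁ * (n * Real.log n) + 2 * (K₂ * (n * Real.log n)) + K₃ * (n * Real.log n)
          + K₄ * (n * Real.log n) + 16 * (n * Real.log n) := by linarith only [f1, f2, f3, f4]
      _ = _ := by ring

/-! ### Asymptotics. -/

theorem dTV_nonneg {α : Type*} [Fintype α] [MeasurableSpace α] (P Q : Measure α) : 0 ≤ dTV P Q :=
  Finset.sum_nonneg fun _ _ => abs_nonneg _

theorem dTV_triangle {α : Type*} [Fintype α] [MeasurableSpace α] (P Q R : Measure α) :
    dTV P R ≤ dTV P Q + dTV Q R := by
  rw [dTV, dTV, dTV, ← Finset.sum_add_distrib]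
  exact Finset.sum_le_sum fun x _ => abs_sub_le _ _ _

theorem dTV_iidBer_le {z z' : ℝ} (hz : 0 ≤ z) (hz1 : z ≤ 1) (hz' : 0 ≤ z') (hz1' : z' ≤ 1)
    (k : ℕ) : dTV (iidBer k z) (iidBer k z') ≤ 2 * k * |z - z'| := by
  refine le_trans (le_of_eq ?_) (sum_abs_prod_berWeight_sub_le hz hz1 hz' hz1' k)
  exact Finset.sum_congr rfl fun x _ => by
    rw [iidBer_real_singleton hz hz1, iidBer_real_singleton hz' hz1']

theorem topSize_le_rpow (n : ℕ) (δ : ℝ) : (topSize n δ : ℝ) ≤ (n : ℝ) ^ δ :=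
  Nat.floor_le (by positivity)

theorem one_le_topSize {n : ℕ} {δ : ℝ} (hn : 1 ≤ n) (hδ : 0 ≤ δ) : 1 ≤ topSize n δ := by
  rw [topSize, Nat.one_le_floor_iff]
  exact Real.one_le_rpow (by exact_mod_cast hn) hδ

theorem rpow_le_two_mul_topSize {n : ℕ} {δ : ℝ} (hn : 1 ≤ n) (hδ : 0 ≤ δ) :
    (n : ℝ) ^ δ ≤ 2 * topSize n δ := by
  have h1 : (1 : ℝ) ≤ topSize n δ := by exact_mod_cast one_le_topSize hn hδ
  have h2 : (n : ℝ) ^ δ < topSize n δ + 1 := Nat.lt_floor_add_one _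
  linarith

theorem topSize_pow_three_le {n : ℕ} {δ : ℝ} (hn : 1 ≤ n) (hδ : δ ≤ 2 / 3) :
    (topSize n δ : ℝ) ^ 3 ≤ (n : ℝ) ^ 2 := by
  have hn' : (1 : ℝ) ≤ n := by exact_mod_cast hn
  calc (topSize n δ : ℝ) ^ 3 ≤ ((n : ℝ) ^ δ) ^ 3 := by
        gcongr; exact topSize_le_rpow n δ
    _ = (n : ℝ) ^ (δ * 3) := by rw [Real.rpow_mul (by positivity)]; norm_num
    _ ≤ (n : ℝ) ^ (2 : ℝ) := Real.rpow_le_rpow_of_exponent_le hn' (by linarith)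
    _ = (n : ℝ) ^ 2 := by norm_num

theorem eventually_topSize_add_two_le {δ ε : ℝ} (hδ : δ < 1) (hε : 0 < ε) :
    ∀ᶠ n : ℕ in atTop, (topSize n δ + 2 : ℝ) ≤ ε * n := by
  have h1 : Tendsto (fun n : ℕ => (n : ℝ) ^ (-(1 - δ)) + 2 / n) atTop (𝓝 (0 + 0)) :=
    ((tendsto_rpow_neg_atTop (by linarith)).comp tendsto_natCast_atTop_atTop).add
      (tendsto_const_div_atTop_nhds_zero_nat 2)
  rw [add_zero] at h1
  filter_upwards [h1.eventually (gt_mem_nhds hε), eventually_ge_atTop 1] with n hn hn1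
  have hn0 : (0 : ℝ) < n := by exact_mod_cast hn1
  have e : (n : ℝ) ^ δ = (n : ℝ) ^ (-(1 - δ)) * n := by
    nth_rewrite 3 [← Real.rpow_one (n : ℝ)]
    rw [← Real.rpow_add hn0]; congr 1; ring
  calc (topSize n δ + 2 : ℝ) ≤ (n : ℝ) ^ δ + 2 := by gcongr; exact topSize_le_rpow n δ
    _ = ((n : ℝ) ^ (-(1 - δ)) + 2 / n) * n := by rw [add_mul, ← e]; field_simp
    _ ≤ ε * n := by gcongr

theorem tendsto_rpow_div_log_atTop {s : ℝ} (hs : 0 < s) :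
    Tendsto (fun n : ℕ => (n : ℝ) ^ s / Real.log n) atTop atTop := by
  have h1 : Tendsto (fun x : ℝ => Real.log x / x ^ s) atTop (𝓝[>] 0) := by
    rw [tendsto_nhdsWithin_iff]
    refine ⟨(isLittleO_log_rpow_atTop hs).tendsto_div_nhds_zero, ?_⟩
    filter_upwards [eventually_gt_atTop 1] with x hx
    exact div_pos (Real.log_pos hx) (Real.rpow_pos_of_pos (by linarith) _)
  refine (h1.inv_tendsto_nhdsGT_zero.comp tendsto_natCast_atTop_atTop).congr fun n => ?_
  simp

/-- This bounds `L / J` by a multiple of `(k + 1) * log n / h`, where `h` is of order at most `m * W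
/ n`. As `W ≥ k + 1`, rounding down the number of segments loses at most a factor `2`. -/
theorem le_mul_of_blocks_count {n m W k : ℕ} {h K : ℝ} (hn : 3 ≤ n) (hh : 0 < h) (hK : 0 < K)
    (hmW : h * n ≤ 4 * m * W) (hW : k + 1 ≤ W) :
    K * (n * Real.log n) ≤ 8 * K * ((k + 1) / (h / Real.log n)) * (m * (W / (k + 1)) : ℕ) := by
  have hn3 : (3 : ℝ) ≤ n := by exact_mod_cast hn
  have hlog : 0 < Real.log n := Real.log_pos (by linarith)
  have hq1 : 1 ≤ W / (k + 1) := (Nat.one_le_div_iff (Nat.succ_pos k)).2 hW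
  have hq2 : W ≤ 2 * ((k + 1) * (W / (k + 1))) := by
    have h1 := Nat.lt_mul_div_succ W (Nat.succ_pos k)
    have h2 : k + 1 ≤ (k + 1) * (W / (k + 1)) := Nat.le_mul_of_pos_right _ hq1
    rw [Nat.succ_eq_add_one, mul_add, mul_one] at h1
    omega
  have hq3 : (W : ℝ) ≤ 2 * ((k + 1) * (W / (k + 1) : ℕ)) := by exact_mod_cast hq2
  have h1 : h * n ≤ 8 * (k + 1) * (m * (W / (k + 1) : ℕ)) := by
    calc h * n ≤ 4 * m * W := hmW
      _ ≤ 4 * m * (2 * ((k + 1) * (W / (k + 1) : ℕ))) := by gcongr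
      _ = _ := by ring
  rw [Nat.cast_mul]
  calc K * (n * Real.log n) = K * Real.log n / h * (h * n) := by field_simp
    _ ≤ K * Real.log n / h * (8 * (k + 1) * (m * (W / (k + 1) : ℕ))) := by gcongr
    _ = _ := by field_simp

theorem tendsto_add_one_div {k : ℕ → ℕ} {G : ℕ → ℝ} (hG : Tendsto G atTop atTop)
    (hk : (fun n : ℕ => (k n : ℝ)) =o[atTop] G) :
    Tendsto (fun n => ((k n : ℝ) + 1) / G n) atTop (𝓝 0) := by
  have h := hk.tendsto_div_nhds_zero.add (tendsto_const_nhds (x := (1 : ℝ)).div_atTop hG)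
  rw [add_zero] at h
  exact h.congr fun n => by rw [add_div]

/-- The radical is nonnegative, so `B < 1 / C`: the side mean `B * C` is a probability below `1`. -/
theorem mul_lt_one_of_lt {B C : ℝ} (hC : 0 < C) (hB : B < 1 / (√(C / 3 - C ^ 2 / 3) + C)) :
    B * C < 1 := by
  have h : 0 ≤ √(C / 3 - C ^ 2 / 3) := Real.sqrt_nonneg _
  have h1 : B < 1 / C := hB.trans_le (one_div_le_one_div_of_le hC (by linarith))
  rwa [lt_div_iff₀ hC] at h1

theorem tableSet_nonempty_iff {n : ℕ} {δ B C : ℝ} :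
    (tableSet n δ B C).Nonempty ↔ 0 < (tabs (margin n δ B C) (margin n δ B C)).card := by
  rw [tableSet, ← coe_tabs, Finset.coe_nonempty, Finset.card_pos]

/-! ### The three limits. -/

theorem bottomRight_limit {δ B C : ℝ} (hC : 0 < C) {k : ℕ → ℕ} (hδ0 : 0 ≤ δ)
    (hδ : δ < 1) (hC1 : C < 1) (hBC : B ≤ 1 / C)
    (hk : (fun n : ℕ => (k n : ℝ)) =o[atTop] (fun n : ℕ => (n : ℝ) ^ (1 - δ))) :
    (∀ᶠ n in atTop, (tableSet n δ B C).Nonempty ∧ k n ≤ n) ∧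
      Tendsto (fun n : ℕ =>
          dTV (rowLaw n δ B C (topSize n δ + 1) (topSize n δ) (k n)) (iidBer (k n) C))
        atTop (𝓝 0) := by
  rw [le_div_iff₀ hC] at hBC
  have hk0 := hk.tendsto_div_nhds_zero
  have hev : ∀ᶠ n : ℕ in atTop, 1 ≤ n ∧ (tableSet n δ B C).Nonempty ∧
      (k n : ℝ) ≤ n / 2 ∧ (n : ℝ) ^ (1 - δ) ≤ n := by
    filter_upwards [eventually_ge_atTop 1, eventually_topSize_add_two_le hδ hC,
      hk0.eventually (gt_mem_nhds (show (0 : ℝ) < 1 / 2 by norm_num))] with n hn hm hkn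
    have hn0 : (0 : ℝ) < n := by exact_mod_cast hn
    have hn1 : (1 : ℝ) ≤ n := by exact_mod_cast hn
    have hpow : (n : ℝ) ^ (1 - δ) ≤ n := by
      calc (n : ℝ) ^ (1 - δ) ≤ (n : ℝ) ^ (1 : ℝ) :=
            Real.rpow_le_rpow_of_exponent_le hn1 (by linarith)
        _ = n := Real.rpow_one _
    refine ⟨hn, ?_, ?_, hpow⟩
    · rw [tableSet_nonempty_iff, margin_eq_twoStep]
      refine card_tabs_twoStep_pos hn ?_ ?_ ?_
      · exact Nat.floor_le_of_le (mul_le_of_le_one_left hn0.le hBC)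
      · exact Nat.floor_le_of_le (mul_le_of_le_one_left hn0.le hC1.le)
      · have := Nat.lt_floor_add_one (C * n)
        have : (topSize n δ : ℝ) < ⌊C * n⌋₊ := by linarith
        exact_mod_cast this
    · rw [div_lt_iff₀ (Real.rpow_pos_of_pos hn0 _)] at hkn
      linarith
  refine ⟨hev.mono fun n h => ⟨h.2.1, ?_⟩, ?_⟩
  · have h0 : (0 : ℝ) ≤ n := Nat.cast_nonneg n
    have : (k n : ℝ) ≤ n := h.2.2.1.trans (by linarith)
    exact_mod_cast this
  · have hlim : Tendsto (fun n : ℕ => 8 * ((k n : ℝ) / (n : ℝ) ^ (1 - δ))) atTop (𝓝 0) := by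
      simpa using hk0.const_mul 8
    refine squeeze_zero' (Eventually.of_forall fun n => dTV_nonneg _ _) ?_ hlim
    filter_upwards [hev] with n ⟨hn, hne, hkn, hpow⟩
    have hn0 : (0 : ℝ) < n := by exact_mod_cast hn
    have hn1 : (1 : ℝ) ≤ n := by exact_mod_cast hn
    have hk' : k n ≤ n := by
      have : (k n : ℝ) ≤ n := hkn.trans (by linarith)
      exact_mod_cast this
    have hk0 : (0 : ℝ) ≤ k n := Nat.cast_nonneg _
    have hp : 0 < (n : ℝ) ^ (1 - δ) := Real.rpow_pos_of_pos hn0 _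
    refine (dTV_bottomRight_le hn hC.le hC1.le hk' (Finset.card_pos.1
      (tableSet_nonempty_iff.1 hne))).trans ?_
    rw [Nat.cast_sub hk']
    have h1 : (k n : ℝ) / (n - k n + 1) ≤ 2 * (k n / (n : ℝ) ^ (1 - δ)) := by
      calc (k n : ℝ) / (n - k n + 1) ≤ k n / ((n : ℝ) ^ (1 - δ) / 2) := by
            gcongr; linarith
        _ = _ := by field_simp
    have h2 : ((topSize n δ : ℝ) + 1) / n ≤ 2 / (n : ℝ) ^ (1 - δ) := by
      rw [div_le_div_iff₀ hn0 hp]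
      have h3 := topSize_le_rpow n δ
      have h4 : (1 : ℝ) ≤ (n : ℝ) ^ δ := Real.one_le_rpow hn1 hδ0
      calc ((topSize n δ : ℝ) + 1) * (n : ℝ) ^ (1 - δ)
          ≤ (2 * (n : ℝ) ^ δ) * (n : ℝ) ^ (1 - δ) := by gcongr; linarith
        _ = 2 * n := by
            rw [mul_assoc, ← Real.rpow_add hn0]; simp
    calc 2 * ((k n : ℝ) / (n - k n + 1)) + 2 * k n * ((topSize n δ + 1) / n)
        ≤ 2 * (2 * (k n / (n : ℝ) ^ (1 - δ))) + 2 * k n * (2 / (n : ℝ) ^ (1 - δ)) := by gcongr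
      _ = _ := by ring

/-- A row of a block of width `W n` in the first rows is asymptotically independent. -/
theorem topRow_limit {δ B C : ℝ} (hB : 0 < B) (hC : 0 < C) (hδ0 : 0 < δ) (hδ : δ ≤ 2 / 3)
    (hC1 : C < 1) (hBC : B * C < 1) {k W j v : ℕ → ℕ} {h : ℕ → ℝ} {z₀ : ℝ}
    (mean : ℝ → ℝ)
    (hh : ∀ᶠ n : ℕ in atTop, 0 < h n ∧ h n * n ≤ 4 * topSize n δ * W n ∧ h n ≤ 2 * W n)
    (hG : Tendsto (fun n : ℕ => h n / Real.log n) atTop atTop)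
    (hk : (fun n : ℕ => (k n : ℝ)) =o[atTop] (fun n : ℕ => h n / Real.log n))
    (hjW : ∀ n, j n + W n ≤ topSize n δ + n)
    (hv : ∀ n, ∀ y : Fin (topSize n δ + n), j n ≤ y → (y : ℕ) < j n + W n →
      margin n δ B C y = v n)
    (hz : ∀ n, ∀ i y : Fin (topSize n δ + n), ∀ z₁₁ z₂₂ : ℝ, (i : ℕ) < topSize n δ → j n ≤ y →
      (y : ℕ) < j n + W n → blockMean (topSize n δ) n z₁₁ (B * C) z₂₂ (i, y) = mean z₁₁)
    (hmean0 : ∀ x, 0 < x → x < 1 → 0 ≤ mean x ∧ mean x ≤ 1) (hz₀ : 0 ≤ z₀) (hz₀1 : z₀ ≤ 1)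
    (herr : ∀ K : ℝ, 0 < K → ∀ᶠ n : ℕ in atTop, ∀ x, |x - topLeftMean B C| ≤ K * (topSize n δ / n) →
      k n * |mean x - z₀| ≤ K * (k n / (h n / Real.log n))) :
    (∀ᶠ n in atTop, (tableSet n δ B C).Nonempty ∧ k n ≤ W n) ∧
      Tendsto (fun n : ℕ => dTV (rowLaw n δ B C 1 (j n) (k n)) (iidBer (k n) z₀)) atTop (𝓝 0) := by
  -- Here `h n` plays the role of `m * W / n`, so `k = o(h / log n)` means `L / J → 0`. The function
  -- `mean` sends the top left mean `z₁₁`, which depends on `n`, to the mean of the block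
  -- considered; `herr` controls the passage from it to the limit `z₀`.
  obtain ⟨K, hK, H⟩ := exists_blockMean hB hC hC1 hBC
  have hδ1 : δ < 1 := by linarith
  have hr := tendsto_add_one_div hG hk
  have hr8 : Tendsto (fun n => 8 * K * (((k n : ℝ) + 1) / (h n / Real.log n))) atTop (𝓝 0) := by
    simpa using hr.const_mul (8 * K)
  have hev : ∀ᶠ n : ℕ in atTop, k n ≤ W n ∧ (tableSet n δ B C).Nonempty ∧
      dTV (rowLaw n δ B C 1 (j n) (k n)) (iidBer (k n) z₀)
        ≤ 4 * √(8 * K * (((k n : ℝ) + 1) / (h n / Real.log n)))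
          + 2 * (K * (k n / (h n / Real.log n))) := by
    filter_upwards [eventually_ge_atTop 3, hh, herr K hK,
      eventually_topSize_add_two_le hδ1 (mul_pos hB hC), eventually_topSize_add_two_le hδ1 hC,
      eventually_topSize_add_two_le hδ1 one_pos,
      eventually_topSize_add_two_le hδ1 (show 0 < 1 / (2 * B) by positivity),
      hr.eventually (gt_mem_nhds (show (0 : ℝ) < 1 / 2 by norm_num)),
      hr8.eventually (gt_mem_nhds (show (0 : ℝ) < 1 by norm_num))]
      with n hn ⟨hh0, hmW, hhW⟩ herrn hm1 hm2 hm3 hm4 hr1 hr2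
    have hn3 : (3 : ℝ) ≤ n := by exact_mod_cast hn
    have hn0 : (0 : ℝ) < n := by linarith
    have hlog1 : 1 ≤ Real.log n := by
      rw [Real.le_log_iff_exp_le hn0]
      exact (Real.exp_one_lt_d9.le.trans (by norm_num)).trans hn3
    have hlog0 : 0 < Real.log n := by linarith
    have hm : 1 ≤ topSize n δ := one_le_topSize (by omega) hδ0.le
    have hmn : topSize n δ ≤ n := by
      have : (topSize n δ : ℝ) ≤ n := by linarith
      exact_mod_cast this
    have hkW : k n + 1 ≤ W n := by
      rw [div_lt_iff₀ (by positivity)] at hr1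
      have h1 : h n / Real.log n ≤ h n := div_le_self hh0.le hlog1
      have : ((k n : ℝ) + 1) ≤ W n := by linarith
      exact_mod_cast this
    obtain ⟨z₁₁, z₂₂, h11, h11', h22, h22', hdist, c₀, hc₀, hconst, hexp⟩ := H (topSize n δ) n hn hm
      (topSize_pow_three_le (by omega) hδ) hmn hm1 hm2 (by
        have : (topSize n δ : ℝ) ≤ 1 / (2 * B) * n := by linarith
        calc (topSize n δ : ℝ) * (2 * B) ≤ 1 / (2 * B) * n * (2 * B) := by gcongr
          _ = n := by field_simp)
    have hL0 : 0 < K * (n * Real.log n) := by positivity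
    have hLJ := le_mul_of_blocks_count hn hh0 hK hmW hkW
    have hJ0 : (0 : ℝ) ≤ (topSize n δ * (W n / (k n + 1)) : ℕ) := Nat.cast_nonneg _
    have hLJ1 : K * (n * Real.log n) ≤ (topSize n δ * (W n / (k n + 1)) : ℕ) :=
      hLJ.trans (mul_le_of_le_one_left hJ0 hr2.le)
    have hJpos := hL0.trans_le hLJ1
    obtain ⟨hz0, hz1⟩ := hmean0 z₁₁ h11 h11'
    refine ⟨by omega, ?_, ?_⟩
    · rw [tableSet_nonempty_iff]
      have : (0 : ℝ) < (tabs (margin n δ B C) (margin n δ B C)).card * c₀ :=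
        (Real.exp_pos _).trans_le hexp
      exact_mod_cast pos_of_mul_pos_left this hc₀.le
    · have hrow := dTV_topRow_le (k := k n) (by omega) (hjW n) (hv n) h11.le h11'.le (by positivity)
        hBC.le h22.le h22'.le hz0 hz1 (fun i y => hz n i y z₁₁ z₂₂) hc₀ hconst hexp hL0 hLJ1
      have hber := dTV_iidBer_le hz0 hz1 hz₀ hz₀1 (k n)
      have hsq : √(K * (n * Real.log n) / (topSize n δ * (W n / (k n + 1)) : ℕ))
          ≤ √(8 * K * (((k n : ℝ) + 1) / (h n / Real.log n))) :=
        Real.sqrt_le_sqrt ((div_le_iff₀ hJpos).2 hLJ)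
      have herr' := herrn z₁₁ hdist
      refine (dTV_triangle _ (iidBer (k n) (mean z₁₁)) _).trans ?_
      linarith
  refine ⟨hev.mono fun n h => ⟨h.2.1, h.1⟩, ?_⟩
  refine squeeze_zero' (Eventually.of_forall fun n => dTV_nonneg _ _)
    (hev.mono fun n h => h.2.2) ?_
  have h1 := (hr8.sqrt.const_mul 4).add ((hk.tendsto_div_nhds_zero.const_mul K).const_mul 2)
  simpa using h1

/-- The window is the top left block itself: `W = m`, and `m * W / n` is of order `n ^ (2 * δ - 1)`.
-/
theorem topLeft_limit {δ B C : ℝ} (hB : 0 < B) (hC : 0 < C) {k : ℕ → ℕ} (hδ0 : 1 / 2 < δ)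
    (hδ : δ ≤ 2 / 3) (hC1 : C < 1) (hBC : B * C < 1)
    (hk : (fun n : ℕ => (k n : ℝ)) =o[atTop] (fun n : ℕ => (n : ℝ) ^ (2 * δ - 1) / Real.log n)) :
    (∀ᶠ n in atTop, (tableSet n δ B C).Nonempty ∧ k n ≤ topSize n δ) ∧
      Tendsto (fun n : ℕ => dTV (rowLaw n δ B C 1 0 (k n)) (iidBer (k n) (topLeftMean B C)))
        atTop (𝓝 0) := by
  obtain ⟨ht0, ht1⟩ := topLeftMean_mem (B := B) hC hC1
  refine topRow_limit hB hC (by linarith) hδ hC1 hBC (W := fun n => topSize n δ) (j := fun _ => 0)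
    (v := fun n => ⌊B * C * n⌋₊) (h := fun n => (n : ℝ) ^ (2 * δ - 1)) id ?_
    (tendsto_rpow_div_log_atTop (by linarith)) hk (fun n => by omega) ?_ ?_
    (fun x hx hx1 => ⟨hx.le, hx1.le⟩) ht0 ht1 ?_
  · filter_upwards [eventually_ge_atTop 1] with n hn
    have hn0 : (0 : ℝ) < n := by exact_mod_cast hn
    have hn1 : (1 : ℝ) ≤ n := by exact_mod_cast hn
    have h1 := rpow_le_two_mul_topSize (δ := δ) hn (by linarith)
    have hp : 0 < (n : ℝ) ^ δ := Real.rpow_pos_of_pos hn0 _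
    refine ⟨Real.rpow_pos_of_pos hn0 _, ?_, ?_⟩
    · calc (n : ℝ) ^ (2 * δ - 1) * n = (n : ℝ) ^ δ * (n : ℝ) ^ δ := by
            rw [← Real.rpow_add hn0]
            nth_rewrite 2 [← Real.rpow_one (n : ℝ)]
            rw [← Real.rpow_add hn0]; congr 1; ring
        _ ≤ (2 * topSize n δ) * (2 * topSize n δ) := by gcongr
        _ = _ := by ring
    · exact (Real.rpow_le_rpow_of_exponent_le hn1 (by linarith)).trans h1
  · intro n y _ hy
    rw [margin_eq_twoStep]; exact if_pos (by omega)
  · intro n i y z₁₁ z₂₂ hi _ hy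
    rw [blockMean, if_pos hi, if_pos (by simpa using hy)]
    rfl
  · intro K hK
    filter_upwards [eventually_ge_atTop 3] with n hn x hx
    have hn3 : (3 : ℝ) ≤ n := by exact_mod_cast hn
    have hn0 : (0 : ℝ) < n := by linarith
    have hlog1 : 1 ≤ Real.log n := by
      rw [Real.le_log_iff_exp_le hn0]
      exact (Real.exp_one_lt_d9.le.trans (by norm_num)).trans hn3
    -- The block mean converges at rate `m / n`, which is fast enough because `δ + (2 * δ - 1) ≤ 1`,
    -- that is `δ ≤ 2 / 3`.
    have h1 : (topSize n δ : ℝ) / n ≤ 1 / ((n : ℝ) ^ (2 * δ - 1) / Real.log n) := by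
      rw [one_div_div, div_le_div_iff₀ hn0 (Real.rpow_pos_of_pos hn0 _)]
      calc (topSize n δ : ℝ) * (n : ℝ) ^ (2 * δ - 1)
          ≤ (n : ℝ) ^ δ * (n : ℝ) ^ (2 * δ - 1) := by gcongr; exact topSize_le_rpow n δ
        _ = (n : ℝ) ^ (3 * δ - 1) := by rw [← Real.rpow_add hn0]; congr 1; ring
        _ ≤ (n : ℝ) ^ (1 : ℝ) := Real.rpow_le_rpow_of_exponent_le (by linarith) (by linarith)
        _ = 1 * n := by rw [Real.rpow_one, one_mul]
        _ ≤ Real.log n * n := by gcongr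
    calc (k n : ℝ) * |id x - topLeftMean B C| ≤ k n * (K * (topSize n δ / n)) := by
          gcongr; exact hx
      _ ≤ k n * (K * (1 / ((n : ℝ) ^ (2 * δ - 1) / Real.log n))) := by gcongr
      _ = _ := by ring

/-- Now `W = n`, so `m * W / n` is of order `n ^ δ`. The block mean is exactly `B * C`, so no error
of the mean arises, and the argument reaches up to `δ = 2 / 3`. -/
theorem sideBlock_limit {δ B C : ℝ} (hB : 0 < B) (hC : 0 < C) {k : ℕ → ℕ} (hδ0 : 0 < δ)
    (hδ : δ ≤ 2 / 3) (hC1 : C < 1) (hBC : B * C < 1)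
    (hk : (fun n : ℕ => (k n : ℝ)) =o[atTop] (fun n : ℕ => (n : ℝ) ^ δ / Real.log n)) :
    (∀ᶠ n in atTop, (tableSet n δ B C).Nonempty ∧ k n ≤ n) ∧
      Tendsto (fun n : ℕ => dTV (rowLaw n δ B C 1 (topSize n δ) (k n)) (iidBer (k n) (B * C)))
        atTop (𝓝 0) := by
  have hBC0 : 0 ≤ B * C := by positivity
  refine topRow_limit hB hC hδ0 hδ hC1 hBC (W := fun n => n) (j := fun n => topSize n δ)
    (v := fun n => ⌊C * n⌋₊) (h := fun n => (n : ℝ) ^ δ) (fun _ => B * C) ?_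
    (tendsto_rpow_div_log_atTop hδ0) hk (fun n => le_rfl) ?_ ?_
    (fun x _ _ => ⟨hBC0, hBC.le⟩) hBC0 hBC.le ?_
  · filter_upwards [eventually_ge_atTop 1] with n hn
    have hn0 : (0 : ℝ) < n := by exact_mod_cast hn
    have hn1 : (1 : ℝ) ≤ n := by exact_mod_cast hn
    have h1 := rpow_le_two_mul_topSize (δ := δ) hn hδ0.le
    refine ⟨Real.rpow_pos_of_pos hn0 _, ?_, ?_⟩
    · have : (0 : ℝ) ≤ topSize n δ := Nat.cast_nonneg _
      gcongr
      linarith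
    · calc (n : ℝ) ^ δ ≤ (n : ℝ) ^ (1 : ℝ) :=
            Real.rpow_le_rpow_of_exponent_le hn1 (by linarith)
        _ ≤ 2 * n := by rw [Real.rpow_one]; linarith
  · intro n y hy _
    rw [margin_eq_twoStep]; exact if_neg (not_lt.2 hy)
  · intro n i y z₁₁ z₂₂ hi hy _
    rw [blockMean, if_pos hi, if_neg (not_lt.2 hy)]
  · intro K hK
    filter_upwards [eventually_ge_atTop 3] with n hn x _
    have hn3 : (3 : ℝ) ≤ n := by exact_mod_cast hn
    have : 0 ≤ Real.log n := Real.log_nonneg (by linarith)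
    rw [sub_self, abs_zero, mul_zero]
    positivity

end BinaryContingency

theorem mainTheorem2 (δ B C : ℝ) (hB : 0 < B) (hC : 0 < C) (k : ℕ → ℕ) :
    -- bottom right block
    (0 ≤ δ → δ < 1 → C < 1 → B ≤ 1 / C →
      (fun n : ℕ => (k n : ℝ)) =o[atTop] (fun n : ℕ => (n : ℝ) ^ (1 - δ)) →
      (∀ᶠ n in atTop, (tableSet n δ B C).Nonempty ∧ k n ≤ n) ∧
      Tendsto (fun n : ℕ =>
          dTV (rowLaw n δ B C (topSize n δ + 1) (topSize n δ) (k n)) (iidBer (k n) C))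
        atTop (𝓝 0)) ∧
    -- top left block
    (1 / 2 < δ → δ ≤ 2 / 3 → C < 3 / 4 → B < 1 / (√(C / 3 - C ^ 2 / 3) + C) →
      (fun n : ℕ => (k n : ℝ)) =o[atTop] (fun n : ℕ => (n : ℝ) ^ (2 * δ - 1) / Real.log n) →
      (∀ᶠ n in atTop, (tableSet n δ B C).Nonempty ∧ k n ≤ topSize n δ) ∧
      Tendsto (fun n : ℕ =>
          dTV (rowLaw n δ B C 1 0 (k n)) (iidBer (k n) (topLeftMean B C)))
        atTop (𝓝 0)) ∧
    -- side block
    (0 < δ → δ ≤ 1 / 2 → C < 3 / 4 → B < 1 / (√(C / 3 - C ^ 2 / 3) + C) →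
      (fun n : ℕ => (k n : ℝ)) =o[atTop] (fun n : ℕ => (n : ℝ) ^ δ / Real.log n) →
      (∀ᶠ n in atTop, (tableSet n δ B C).Nonempty ∧ k n ≤ n) ∧
      Tendsto (fun n : ℕ =>
          dTV (rowLaw n δ B C 1 (topSize n δ) (k n)) (iidBer (k n) (B * C)))
        atTop (𝓝 0)) := by
  refine ⟨fun hδ0 hδ hC1 hBC hk => bottomRight_limit hC hδ0 hδ hC1 hBC hk,
    fun hδ0 hδ hC1 hBC hk => ?_, fun hδ0 hδ hC1 hBC hk => ?_⟩
  · exact topLeft_limit hB hC hδ0 hδ (by linarith) (mul_lt_one_of_lt hC hBC) hk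
  · exact sideBlock_limit hB hC hδ0 (by linarith) (by linarith) (mul_lt_one_of_lt hC hBC) hk
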